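/- Let $f:\mathbb C\to\hat{\mathbb C}=\mathbb C\cup\{\infty\}$ be a meromorphic function. An iterate $f^n$ is defined and finite at $z\in\mathbb C$ if none of $z,f(z),\dots,f^{n-1}(z)$ is a pole of $f$. Let $J(f)\subset\mathbb C$ be the Julia set of $f$ in the plane, that is, the complement in $\mathbb C$ of the set of points that have a neighbourhood on which all iterates $f^n$ are defined and form a normal family (for the chordal metric on $\hat{\mathbb C}$). Let $\mathrm{sing}(f^{-1})$ be the set of finite critical values and finite asymptotic values of $f$, and let $\mathcal P_f$ be the closure in $\mathbb C$ of the set of all $f^n(s)$ with $n\ge 0$, $s\in\mathrm{sing}(f^{-1})$ and $f^n$ defined and finite at $s$. The function $f$ is called * topologically hyperbolic if $\mathrm{dist}(J(f),\mathcal P_f)=\inf\{|z-w|: z\in J(f),\ w\in\mathcal P_f\}>0$ (with $\inf\emptyset=+\infty$); * expanding if there are $c>0$ and $\lambda>1$ such that $|(f^n)'(z)|\ge c\lambda^n$ for all $n\ge 0$ and all $z\in J(f)$ at which $f^n$ is defined and finite; * hyperbolic if it is topologically hyperbolic and expanding. Let $\alpha_1\ge 0$, and suppose that $f$ is topologically hyperbolic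 and satisfies the rapid derivative growth condition with exponent $\alpha_1$: there are $\alpha_2>\max\{0,-\alpha_1\}$ and $\kappa>0$ such that $$|f'(z)|\ \ge\ \kappa^{-1}\,(1+|z|^{\alpha_1})\,(1+|f(z)|^{\alpha_2})\qquad\text{for all } z\in J(f)\setminus f^{-1}(\infty).$$ Then $f$ is expanding, and consequently hyperbolic. -/

import Mathlib

open Filter Topology

/-!
Meromorphic functions `ℂ → Ĉ = ℂ ∪ {∞}` are represented by functions `f : ℂ → ℂ` in Mathlib's
normal form (`MeromorphicNFOn f Set.univ`): `f` is analytic off its poles, and at a pole (where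
the true value is `∞`) the function takes the dummy value `0`. Every definition below excludes
the poles explicitly, so that the dummy value is never used.
-/

namespace MeroDyn

/-- `z` is a pole of `f`, that is, `f z = ∞` as a map into the Riemann sphere. -/
def IsPole (f : ℂ → ℂ) (z : ℂ) : Prop := meromorphicOrderAt f z < 0

/-- The iterate `f^n` is defined at `z` and its value there is finite: none of the points
`z, f z, …, f^(n-1) z` is a pole of `f`. In this case `f^n z` is `f^[n] z`. -/
def IterateFiniteAt (f : ℂ → ℂ) (n : ℕ) (z : ℂ) : Prop :=
  ∀ k < n, ¬ IsPole f (f^[k] z)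

/-- The chordal metric on the Riemann sphere `ℂ ∪ {∞}`. -/
noncomputable def chordal : OnePoint ℂ → OnePoint ℂ → ℝ
  | some z, some w => 2 * ‖z - w‖ / (√(1 + ‖z‖ ^ 2) * √(1 + ‖w‖ ^ 2))
  | some z, none => 2 / √(1 + ‖z‖ ^ 2)
  | none, some w => 2 / √(1 + ‖w‖ ^ 2)
  | none, none => 0

/-- The family `(F n)` of finite-valued functions is normal on `U`: every sequence of its members
has a subsequence that converges, uniformly on the compact subsets of `U` for the chordal metric,
to a function with values in the Riemann sphere. -/
def IsNormalFamilyOn (F : ℕ → ℂ → ℂ) (U : Set ℂ) : Prop :=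
  ∀ n : ℕ → ℕ, ∃ φ : ℕ → ℕ, StrictMono φ ∧ ∃ g : ℂ → OnePoint ℂ,
    ∀ K ⊆ U, IsCompact K → ∀ ε > 0, ∀ᶠ k in atTop, ∀ z ∈ K,
      chordal (F (n (φ k)) z : OnePoint ℂ) (g z) < ε

/-- The Fatou set in the plane: the points with a neighbourhood on which all iterates of `f` are
defined and form a normal family. (As `f` is not defined at `∞`, all iterates are defined at a
point only if they are all finite there.) -/
def fatouSet (f : ℂ → ℂ) : Set ℂ :=
  {z | ∃ U : Set ℂ, IsOpen U ∧ z ∈ U ∧ (∀ w ∈ U, ∀ n, IterateFiniteAt f n w) ∧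
    IsNormalFamilyOn (fun n => f^[n]) U}

/-- The Julia set in the plane. -/
def juliaSet (f : ℂ → ℂ) : Set ℂ := (fatouSet f)ᶜ

/-- The finite critical values of `f`. -/
def criticalValues (f : ℂ → ℂ) : Set ℂ :=
  {a | ∃ c, ¬ IsPole f c ∧ deriv f c = 0 ∧ f c = a}

/-- The finite asymptotic values of `f`: limits of `f` along curves that tend to `∞`. -/
def asymptoticValues (f : ℂ → ℂ) : Set ℂ :=
  {a | ∃ γ : ℝ → ℂ, Continuous γ ∧ Tendsto (fun t => ‖γ t‖) atTop atTop ∧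
    (∀ᶠ t in atTop, ¬ IsPole f (γ t)) ∧ Tendsto (fun t => f (γ t)) atTop (𝓝 a)}

/-- `sing(f⁻¹)`: the finite critical and asymptotic values. -/
def singularValues (f : ℂ → ℂ) : Set ℂ := criticalValues f ∪ asymptoticValues f

/-- The post-critical set: the closure in the plane of the forward orbits of the singular values,
each followed as long as it is defined and finite. -/
def postcriticalSet (f : ℂ → ℂ) : Set ℂ :=
  closure {w | ∃ n : ℕ, ∃ s ∈ singularValues f, IterateFiniteAt f n s ∧ f^[n] s = w}

/-- The distance of two plane sets, as an infimum in `[0, ∞]`. -/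
noncomputable def setDist (A B : Set ℂ) : ENNReal := ⨅ z ∈ A, ⨅ w ∈ B, edist z w

/-- Topological hyperbolicity: the Julia set and the post-critical set have positive distance. -/
def IsTopologicallyHyperbolic (f : ℂ → ℂ) : Prop :=
  0 < setDist (juliaSet f) (postcriticalSet f)

/-- Expanding: `|(f^n)'(z)| ≥ c λ^n` for all `n` and all `z` in the Julia set at which `f^n` is
defined and finite. -/
def IsExpanding (f : ℂ → ℂ) : Prop :=
  ∃ c > (0 : ℝ), ∃ l > (1 : ℝ), ∀ n : ℕ, ∀ z ∈ juliaSet f, IterateFiniteAt f n z →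
    c * l ^ n ≤ ‖deriv f^[n] z‖

/-- Hyperbolic: topologically hyperbolic and expanding. -/
def IsHyperbolic (f : ℂ → ℂ) : Prop := IsTopologicallyHyperbolic f ∧ IsExpanding f

/-- The rapid derivative growth condition with exponent `α₁` (used here only for `0 ≤ α₁`, where
`‖z‖ ^ α₁` makes sense at `z = 0` too). -/
def HasRapidDerivativeGrowth (f : ℂ → ℂ) (α₁ : ℝ) : Prop :=
  ∃ α₂ > max 0 (-α₁), ∃ κ > (0 : ℝ), ∀ z ∈ juliaSet f, ¬ IsPole f z →
    κ⁻¹ * (1 + ‖z‖ ^ α₁) * (1 + ‖f z‖ ^ α₂) ≤ ‖deriv f z‖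

end MeroDyn

/-! The heart of the matter is that derivatives of iterates cannot stay bounded along long orbits
starting in a bounded part of `juliaSet f`. Let δ > 0 bound from below the distance between the
Julia set and the post-critical set. If `f^m` is finite at y ∈ J(f), the disk of radius δ about `f^m
y` avoids the post-critical set, so it carries a holomorphic branch of the inverse of `f^m` that
sends the centre to y (`exists_inverse_branch`). If moreover the derivatives of `f^n`, n ≤ m, at y
are at most C, Koebe distortion, applied to this branch and then to each `f^n`, gives a disk about
y, of size independent of m and y, on which these iterates have uniformly bounded oscillation
(`exists_ball_bounded_oscillation`). With y bounded and m → ∞, a limit point would have a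
neighbourhood on which all iterates form a normal family, though it lies in the closed set J(f)
(`exists_forall_exists_lt_norm_deriv`).

Rapid growth handles the unbounded part: on J(f), |f'| is at least some b > 0 everywhere, and at
least 2 at points mapped outside a disk of radius R. Orbits are cut at their first and last visits
to this disk. Outside it every step but the entering one gains a factor 2; between visits the
compactness result makes long returns expand strongly. Hence one fixed iterate has derivative at
least 2 on J(f) wherever it is finite, and the chain rule gives exponential growth. -/

/-! ### Path lifting for local homeomorphisms -/

/-- A path lifts through a local homeomorphism as soon as every lift over a half-open initial
interval has a cluster point at the right end. -/
theorem IsLocalHomeomorph.exists_lift_Icc {E X : Type*} [TopologicalSpace E] [TopologicalSpace X]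
    [T2Space E] [T2Space X] {p : E → X} (hp : IsLocalHomeomorph p) {γ : ℝ → X}
    (hγ : ContinuousOn γ (Set.Icc 0 1)) {e : E} (he : p e = γ 0)
    (hcl : ∀ T : ℝ, 0 < T → T ≤ 1 → ∀ z : ℝ → E, ContinuousOn z (Set.Ico 0 T) →
      (∀ t ∈ Set.Ico 0 T, p (z t) = γ t) → ∃ x, MapClusterPt x (𝓝[<] T) z) :
    ∃ z : ℝ → E, ContinuousOn z (Set.Icc 0 1) ∧ z 0 = e ∧ ∀ t ∈ Set.Icc (0 : ℝ) 1, p (z t) = γ t := by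
  set L : ℝ → Prop := fun s => ∃ z : ℝ → E, ContinuousOn z (Set.Icc 0 s) ∧ z 0 = e ∧
    ∀ t ∈ Set.Icc (0 : ℝ) s, p (z t) = γ t with hL
  change L 1
  have hL0 : L 0 := ⟨fun _ => e, continuousOn_const, rfl, fun t ht => by
    rw [le_antisymm ht.2 ht.1]; exact he⟩
  -- A lift up to `s` continues to `s'` by a local inverse whose domain contains the path on `[s,
  -- s']`.
  have hext : ∀ s s' : ℝ, 0 ≤ s → s ≤ s' → s' ≤ 1 → ∀ z : ℝ → E, ContinuousOn z (Set.Icc 0 s) →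
      z 0 = e → (∀ t ∈ Set.Icc (0 : ℝ) s, p (z t) = γ t) → ∀ q : OpenPartialHomeomorph E X,
      p = q → z s ∈ q.source → (∀ t ∈ Set.Icc s s', γ t ∈ q.target) → L s' := by
    intro s s' hs hss' hs' z hz hz0 hzl q hq hzs hqt
    refine ⟨fun t => if t ≤ s then z t else q.symm (γ t), ?_, by simp [hs, hz0], ?_⟩
    · have hU : Set.Icc 0 s' = Set.Icc 0 s ∪ Set.Icc s s' := (Set.Icc_union_Icc_eq_Icc hs hss').symm
      rw [hU]
      refine ContinuousOn.union_of_isClosed ?_ ?_ isClosed_Icc isClosed_Icc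
      · exact hz.congr fun t ht => if_pos ht.2
      · have h1 : ContinuousOn (fun t => q.symm (γ t)) (Set.Icc s s') :=
          q.continuousOn_symm.comp (hγ.mono (Set.Icc_subset_Icc hs hs')) hqt
        refine h1.congr fun t ht => ?_
        by_cases h : t ≤ s
        · have : t = s := le_antisymm h ht.1
          subst this
          simp only [le_refl, if_true]
          rw [← hzl t ⟨hs, le_rfl⟩, hq, q.left_inv hzs]
        · simp [h]
    · intro t ht
      by_cases h : t ≤ s
      · simp only [h, if_true]; exact hzl t ⟨ht.1, h⟩
      · simp only [h, if_false]
        rw [hq, q.right_inv (hqt t ⟨(not_le.1 h).le, ht.2⟩)]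
  set S : Set ℝ := {s | s ∈ Set.Icc (0 : ℝ) 1 ∧ L s} with hS
  have hSb : BddAbove S := ⟨1, fun s hs => hs.1.2⟩
  have h0S : (0 : ℝ) ∈ S := ⟨⟨le_rfl, zero_le_one⟩, hL0⟩
  set T := sSup S with hT
  have hT0 : 0 ≤ T := le_csSup hSb h0S
  have hT1 : T ≤ 1 := csSup_le ⟨0, h0S⟩ fun s hs => hs.1.2
  have hlt : ∀ t, t < T → L t := by
    intro t ht
    obtain ⟨s, hsS, hts⟩ := exists_lt_of_lt_csSup ⟨0, h0S⟩ ht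
    obtain ⟨z, h1, h2, h3⟩ := hsS.2
    exact ⟨z, h1.mono (Set.Icc_subset_Icc_right hts.le), h2, fun u hu => h3 u ⟨hu.1, hu.2.trans hts.le⟩⟩
  -- a starting time and a chart that reach beyond `T`
  obtain ⟨q, hq, hTq, s, hs0, hsT, z, hz, hz0, hzl, hzq, hsq⟩ :
      ∃ q : OpenPartialHomeomorph E X, p = q ∧ γ T ∈ q.target ∧ ∃ s, 0 ≤ s ∧ s ≤ T ∧ ∃ z : ℝ → E,
        ContinuousOn z (Set.Icc 0 s) ∧ z 0 = e ∧ (∀ t ∈ Set.Icc (0 : ℝ) s, p (z t) = γ t) ∧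
        z s ∈ q.source ∧ ∀ t ∈ Set.Icc s T, γ t ∈ q.target := by
    rcases hT0.eq_or_lt with h0 | h0
    · obtain ⟨q, hqe, hq⟩ := hp e
      have hg : γ 0 ∈ q.target := by rw [← he, hq]; exact q.map_source hqe
      refine ⟨q, hq, h0 ▸ hg, 0, le_rfl, hT0, fun _ => e, continuousOn_const, rfl, fun t ht => ?_,
        hqe, fun t ht => ?_⟩
      · rw [le_antisymm ht.2 ht.1]; exact he
      · rw [← h0] at ht; rw [le_antisymm ht.2 ht.1]; exact hg
    · have hsep : IsSeparatedMap p := T2Space.isSeparatedMap p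
      have : Nonempty (ℝ → E) := ⟨fun _ => e⟩
      -- By uniqueness of lifts the `Z t` are compatible, so the diagonal `t ↦ Z t t` is a lift on
      -- `[0, T)`. A chart at its cluster point contains the lift at times arbitrarily close to `T`,
      -- from where it can be continued.
      choose! Z hZc hZ0 hZl using hlt
      have hagree : ∀ t s, 0 ≤ t → t ≤ s → s < T → Z t t = Z s t := by
        intro t s ht hts hsT
        have := hsep.eqOn_of_comp_eqOn hp.isLocallyInjective (isPreconnected_Icc (a := (0:ℝ)) (b := t))
          (hZc t (hts.trans_lt hsT)) ((hZc s hsT).mono (Set.Icc_subset_Icc_right hts))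
          (fun u hu => by
            simp only [Function.comp]
            rw [hZl t (hts.trans_lt hsT) u hu, hZl s hsT u ⟨hu.1, hu.2.trans hts⟩])
          (a := 0) ⟨le_rfl, ht⟩ (by rw [hZ0 t (hts.trans_lt hsT), hZ0 s hsT])
        exact this ⟨ht, le_rfl⟩
      have hzc : ContinuousOn (fun t => Z t t) (Set.Ico 0 T) := by
        intro t ht
        obtain ⟨s, hts, hsT⟩ := exists_between ht.2
        have h1 : ContinuousWithinAt (Z s) (Set.Icc 0 s) t := hZc s hsT t ⟨ht.1, hts.le⟩
        have h2 : ContinuousWithinAt (fun t => Z t t) (Set.Icc 0 s) t :=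
          h1.congr (fun u hu => hagree u s hu.1 hu.2 hsT) (hagree t s ht.1 hts.le hsT)
        refine h2.mono_of_mem_nhdsWithin ?_
        filter_upwards [self_mem_nhdsWithin, mem_nhdsWithin_of_mem_nhds (Iio_mem_nhds hts)] with u hu hu'
        exact ⟨hu.1, le_of_lt hu'⟩
      have hzlift : ∀ t ∈ Set.Ico 0 T, p (Z t t) = γ t := fun t ht => hZl t ht.2 t ⟨ht.1, le_rfl⟩
      obtain ⟨x, hx⟩ := hcl T h0 hT1 _ hzc hzlift
      have hIco : Set.Ico 0 T ∈ 𝓝[<] T := Ico_mem_nhdsLT h0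
      have hγT : Tendsto γ (𝓝[<] T) (𝓝 (γ T)) := by
        refine (hγ T ⟨hT0, hT1⟩).mono_left (nhdsWithin_le_iff.2 ?_)
        filter_upwards [hIco] with t ht using ⟨ht.1, ht.2.le.trans hT1⟩
      have hpx : p x = γ T := by
        have h1 : MapClusterPt (p x) (𝓝[<] T) (p ∘ fun t => Z t t) :=
          hx.continuousAt_comp hp.continuous.continuousAt
        have h2 : Tendsto (p ∘ fun t => Z t t) (𝓝[<] T) (𝓝 (γ T)) :=
          hγT.congr' (by filter_upwards [hIco] with t ht using (hzlift t ht).symm)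
        by_contra hne
        exact h1.neBot.ne
          (le_bot_iff.1 ((inf_le_inf_left _ h2).trans (disjoint_nhds_nhds.2 hne).le_bot))
      obtain ⟨q, hqx, hq⟩ := hp x
      have hg : γ T ∈ q.target := by rw [← hpx, hq]; exact q.map_source hqx
      have h3 : ∀ᶠ t in 𝓝[<] T, ∀ u ∈ Set.Icc t T, γ u ∈ q.target := by
        have h4 : ∀ᶠ t in 𝓝[<] T, γ t ∈ q.target := hγT (q.open_target.mem_nhds hg)
        obtain ⟨a, ha, haT⟩ := (mem_nhdsLT_iff_exists_Ioo_subset).1 h4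
        filter_upwards [Ioo_mem_nhdsLT ha] with t ht u hu
        rcases hu.2.eq_or_lt with h | h
        · rw [h]; exact hg
        · exact haT ⟨ht.1.trans_le hu.1, h⟩
      obtain ⟨s, hsx, hs3, hsI⟩ := ((hx.frequently (q.open_source.mem_nhds hqx)).and_eventually
        (h3.and hIco)).exists
      exact ⟨q, hq, hg, s, hsI.1, hsI.2.le, Z s, hZc s hsI.2, hZ0 s hsI.2, hZl s hsI.2, hsx, hs3⟩
  rcases hT1.eq_or_lt with h1 | h1
  · rw [← h1]
    exact hext s T hs0 hsT hT1 z hz hz0 hzl q hq hzq hsq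
  · exfalso
    have h5 : ∀ᶠ t in 𝓝[>] T, ∀ u ∈ Set.Icc T t, γ u ∈ q.target := by
      have h6 : Tendsto γ (𝓝[>] T) (𝓝 (γ T)) := by
        refine (hγ T ⟨hT0, hT1⟩).mono_left (nhdsWithin_le_iff.2 ?_)
        filter_upwards [Ioo_mem_nhdsGT h1] with t ht using ⟨hT0.trans ht.1.le, ht.2.le⟩
      obtain ⟨a, ha, haT⟩ := (mem_nhdsGT_iff_exists_Ioo_subset).1 (h6 (q.open_target.mem_nhds hTq))
      filter_upwards [Ioo_mem_nhdsGT ha] with t ht u hu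
      rcases hu.1.eq_or_lt with h | h
      · rw [← h]; exact hTq
      · exact haT ⟨h, hu.2.trans_lt ht.2⟩
    obtain ⟨t, ht, htI⟩ := (h5.and (Ioo_mem_nhdsGT h1)).exists
    have hLt : L t := hext s t hs0 (hsT.trans htI.1.le) htI.2.le z hz hz0 hzl q hq hzq fun u hu => by
      rcases le_total u T with h | h
      · exact hsq u ⟨hu.1, h⟩
      · exact ht u ⟨h, hu.2⟩
    exact absurd (le_csSup hSb ⟨⟨hT0.trans htI.1.le, htI.2.le⟩, hLt⟩) (not_le.2 htI.1)

/-! ### Holomorphic logarithms and Koebe distortion -/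

/-- A zero-free holomorphic function on a disk has a holomorphic logarithm with prescribed value
at the centre. -/
theorem exists_differentiableOn_exp_eq_on_ball {φ : ℂ → ℂ} {c : ℂ} {R : ℝ} (hR : 0 < R)
    (hφ : DifferentiableOn ℂ φ (Metric.ball c R)) (h0 : ∀ z ∈ Metric.ball c R, φ z ≠ 0)
    {b : ℂ} (hb : Complex.exp b = φ c) :
    ∃ l : ℂ → ℂ, DifferentiableOn ℂ l (Metric.ball c R) ∧ l c = b ∧
      ∀ z ∈ Metric.ball c R, Complex.exp (l z) = φ z := by
  have hφd : DifferentiableOn ℂ (deriv φ) (Metric.ball c R) := hφ.deriv Metric.isOpen_ball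
  have h1 : DifferentiableOn ℂ (fun z => deriv φ z / φ z) (Metric.ball c R) := hφd.div hφ h0
  obtain ⟨l, hlc, hl⟩ := h1.isExactOn_ball.with_val_at c b
  refine ⟨l, fun z hz => (hl z hz).differentiableAt.differentiableWithinAt, hlc, fun z hz => ?_⟩
  have hder : ∀ w ∈ Metric.ball c R, HasDerivAt (fun z => φ z * Complex.exp (-l z)) 0 w := by
    intro w hw
    have hφw : HasDerivAt φ (deriv φ w) w :=
      (hφ.differentiableAt (Metric.isOpen_ball.mem_nhds hw)).hasDerivAt
    refine (hφw.fun_mul (hl w hw).fun_neg.cexp).congr_deriv ?_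
    have := h0 w hw
    field_simp
    ring
  have hconst : φ z * Complex.exp (-l z) = φ c * Complex.exp (-l c) := by
    refine Metric.isOpen_ball.is_const_of_deriv_eq_zero (convex_ball c R).isPreconnected
      (f := fun z => φ z * Complex.exp (-l z))
      (fun w hw => (hder w hw).differentiableAt.differentiableWithinAt)
      (fun w hw => (hder w hw).deriv) hz (Metric.mem_ball_self hR)
  rw [hlc, ← hb, ← Complex.exp_add, add_neg_cancel, Complex.exp_zero, Complex.exp_neg] at hconst
  have := Complex.exp_ne_zero (l z)
  field_simp at hconst
  exact hconst.symm

/-- If a bounded zero-free function on a disk has value `1 / 2` at the centre, it is bounded away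
from zero on the disk of half the radius. -/
theorem norm_inv_le_of_norm_le_four {v : ℂ → ℂ} {c : ℂ} {R : ℝ} (hR : 0 < R)
    (hv : DifferentiableOn ℂ v (Metric.ball c R)) (h0 : ∀ z ∈ Metric.ball c R, v z ≠ 0)
    (h4 : ∀ z ∈ Metric.ball c R, ‖v z‖ ≤ 4) (hc : v c = 1 / 2) :
    ∀ z ∈ Metric.ball c (R / 2), ‖v z‖⁻¹ ≤ Real.exp 10 := by
  have hb : Complex.exp (-(Real.log 2 : ℂ)) = v c := by
    rw [hc, Complex.exp_neg, ← Complex.ofReal_exp, Real.exp_log (by norm_num)]; norm_num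
  obtain ⟨l, hl, hlc, hle⟩ := exists_differentiableOn_exp_eq_on_ball hR hv h0 hb
  intro z hz
  have hlog2 : Real.log 2 ≤ 1 := by
    have := Real.log_le_sub_one_of_pos (show (0:ℝ) < 2 by norm_num); linarith
  have hre : ∀ z ∈ Metric.ball c R, (l z).re ≤ 2 := by
    intro w hw
    have h1 : ‖v w‖ = Real.exp (l w).re := by rw [← hle w hw, Complex.norm_exp]
    have h2 := h4 w hw
    rw [h1] at h2
    have h3 : (4 : ℝ) ≤ Real.exp 2 := by
      have := Real.add_one_le_exp (1 : ℝ)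
      have h5 : Real.exp 2 = Real.exp 1 * Real.exp 1 := by rw [← Real.exp_add]; norm_num
      nlinarith
    exact Real.exp_le_exp.1 (h2.trans h3)
  have hmaps : ∀ u ∈ Metric.ball (0 : ℂ) R, c + u ∈ Metric.ball c R := by
    intro u hu; simpa [Metric.mem_ball, dist_eq_norm] using hu
  have hzR : ‖z - c‖ < R / 2 := by simpa [dist_eq_norm] using hz
  have hdist : DifferentiableOn ℂ (fun u => l (c + u) - l c) (Metric.ball 0 R) := by
    refine DifferentiableOn.sub (hl.comp ?_ hmaps) (differentiableOn_const _)
    exact (differentiable_id.const_add c).differentiableOn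
  -- Here `Re (l - l c) ≤ 2 + log 2 ≤ 3`, so Borel–Carathéodory bounds `‖l - l c‖` by 6 on the half
  -- disk.
  have key := Complex.borelCaratheodory_zero (M := 3) (f := fun u => l (c + u) - l c) (z := z - c)
    (by norm_num) hdist (fun u hu => by
      have h1 := hre _ (hmaps u hu)
      have h2 : (l c).re = -Real.log 2 := by rw [hlc, ← Complex.ofReal_neg, Complex.ofReal_re]
      show (l (c + u) - l c).re ≤ 3
      rw [Complex.sub_re, h2]; linarith) hR (by simpa using hzR.trans (by linarith)) (by simp)
  simp only [add_sub_cancel] at key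
  have h6 : 2 * 3 * ‖z - c‖ / (R - ‖z - c‖) ≤ 6 := by
    rw [div_le_iff₀ (by linarith)]; linarith
  have h7 : -(l z).re ≤ 10 := by
    have h8 := (Complex.abs_re_le_norm (l z - l c)).trans (key.trans h6)
    have h2 : (l c).re = -Real.log 2 := by rw [hlc, ← Complex.ofReal_neg, Complex.ofReal_re]
    rw [Complex.sub_re, h2] at h8
    have := abs_le.1 h8
    linarith [this.1]
  have hzb : z ∈ Metric.ball c R := Metric.ball_subset_ball (by linarith) hz
  rw [← hle z hzb, Complex.norm_exp, ← Real.exp_neg]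
  exact Real.exp_le_exp.2 h7

/-- A form of the Koebe distortion theorem, for a holomorphic function with a holomorphic left
inverse: the image of the disk contains a disk of definite size, and the image of the disk of half
the radius lies in a disk of definite size. -/
theorem koebe_distortion {g F : ℂ → ℂ} {c : ℂ} {R : ℝ} (hR : 0 < R)
    (hg : DifferentiableOn ℂ g (Metric.ball c R))
    (hF : ∀ z ∈ Metric.ball c R, DifferentiableAt ℂ F (g z))
    (hFg : ∀ z ∈ Metric.ball c R, F (g z) = z) :
    Metric.ball (g c) (R * ‖deriv g c‖ / 40) ⊆ g '' Metric.ball c R ∧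
    ∀ z ∈ Metric.ball c (R / 2),
      ‖g z - g c‖ ≤ (1 + (Real.exp 10 + 1) ^ 2) * (R * ‖deriv g c‖) := by
  have hcB : c ∈ Metric.ball c R := Metric.mem_ball_self hR
  have hgat : ∀ z ∈ Metric.ball c R, DifferentiableAt ℂ g z := fun z hz =>
    hg.differentiableAt (Metric.isOpen_ball.mem_nhds hz)
  have hmul : ∀ z ∈ Metric.ball c R, deriv F (g z) * deriv g z = 1 := by
    intro z hz
    have h1 : HasDerivAt (F ∘ g) (deriv F (g z) * deriv g z) z :=
      (hF z hz).hasDerivAt.comp z (hgat z hz).hasDerivAt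
    have h2 : HasDerivAt (F ∘ g) 1 z := by
      refine (hasDerivAt_id z).congr_of_eventuallyEq ?_
      filter_upwards [Metric.isOpen_ball.mem_nhds hz] with w hw using hFg w hw
    exact h1.unique h2
  have hopen : IsOpen (g '' Metric.ball c R) := by
    rw [isOpen_iff_mem_nhds]
    rintro _ ⟨z, hz, rfl⟩
    have hsd : HasStrictDerivAt g (deriv g z) z :=
      (hg.analyticAt (Metric.isOpen_ball.mem_nhds hz)).hasStrictDerivAt
    rw [← hsd.map_nhds_eq (fun h => by simpa [h] using hmul z hz)]
    exact image_mem_map (Metric.isOpen_ball.mem_nhds hz)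
  have hne : (g '' Metric.ball c R)ᶜ.Nonempty := by
    rw [Set.nonempty_compl]
    -- If `g` were onto, `F` would be entire with values in the disk, hence constant by Liouville.
    intro huniv
    have hFd : Differentiable ℂ F := by
      intro x
      obtain ⟨z, hz, rfl⟩ : x ∈ g '' Metric.ball c R := huniv ▸ Set.mem_univ x
      exact hF z hz
    have hFb : Bornology.IsBounded (Set.range F) := by
      refine (Metric.isBounded_ball (x := c) (r := R)).subset ?_
      rintro _ ⟨x, rfl⟩
      obtain ⟨z, hz, rfl⟩ : x ∈ g '' Metric.ball c R := huniv ▸ Set.mem_univ x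
      rw [hFg z hz]; exact hz
    have hz1 : c + (R / 2 : ℝ) ∈ Metric.ball c R := by
      simp [dist_eq_norm, abs_of_pos hR]; linarith
    have h1 := hFd.apply_eq_apply_of_bounded hFb (g c) (g (c + (R / 2 : ℝ)))
    rw [hFg c hcB, hFg _ hz1] at h1
    have : ((R / 2 : ℝ) : ℂ) = 0 := by linear_combination -h1
    rw [Complex.ofReal_eq_zero] at this
    linarith
  -- `a` is an omitted value nearest to `g c`. Both claims reduce to comparing `d` with `R * ‖deriv
  -- g c‖`, through a square root `h` of the zero-free function `(a - g) / (a - g c)`.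
  obtain ⟨a, ha, had⟩ := hopen.isClosed_compl.exists_infDist_eq_dist hne (g c)
  set d := dist (g c) a with hd
  have hac : a ≠ g c := fun h => ha (h ▸ Set.mem_image_of_mem g hcB)
  have hdpos : 0 < d := dist_pos.2 hac.symm
  have hsub : Metric.ball (g c) d ⊆ g '' Metric.ball c R := by
    intro x hx
    by_contra hxn
    have := Metric.infDist_le_dist_of_mem (x := g c) (s := (g '' Metric.ball c R)ᶜ) hxn
    rw [had, dist_comm (g c) x] at this
    exact absurd hx (by simpa [Metric.mem_ball] using this)
  have hacn : ‖a - g c‖ = d := by rw [hd, dist_comm, dist_eq_norm]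
  have hac0 : a - g c ≠ 0 := sub_ne_zero.2 hac
  have hg'pos : 0 < ‖deriv g c‖ := norm_pos_iff.2 fun h => by simpa [h] using hmul c hcB
  -- upper bound for `d` by the Schwarz lemma for the inverse
  have hdle : d ≤ R * ‖deriv g c‖ := by
    have h1 := Complex.norm_deriv_le_div_of_mapsTo_ball (f := F) (c := g c) (R₁ := d) (R₂ := R)
      (fun x hx => by
        obtain ⟨z, hz, rfl⟩ := hsub hx
        exact (hF z hz).differentiableWithinAt)
      (fun x hx => by
        obtain ⟨z, hz, rfl⟩ := hsub hx
        rw [hFg z hz, hFg c hcB]; exact Metric.ball_subset_closedBall hz) hdpos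
    have h2 : ‖deriv F (g c)‖ * ‖deriv g c‖ = 1 := by rw [← norm_mul, hmul c hcB, norm_one]
    rw [le_div_iff₀ hdpos] at h1
    nlinarith
  set φ : ℂ → ℂ := fun z => (a - g z) / (a - g c) with hφ
  have hφd : DifferentiableOn ℂ φ (Metric.ball c R) := (hg.const_sub a).div_const _
  have hφ0 : ∀ z ∈ Metric.ball c R, φ z ≠ 0 := fun z hz =>
    div_ne_zero (sub_ne_zero.2 fun h => ha (h ▸ Set.mem_image_of_mem g hz)) hac0
  have hφc : φ c = 1 := div_self hac0
  obtain ⟨l, hl, hlc, hle⟩ := exists_differentiableOn_exp_eq_on_ball hR hφd hφ0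
    (b := 0) (by rw [hφc, Complex.exp_zero])
  set h : ℂ → ℂ := fun z => Complex.exp (l z / 2) with hh
  have hhd : DifferentiableOn ℂ h (Metric.ball c R) := (hl.div_const 2).cexp
  have hhc : h c = 1 := by simp [hh, hlc]
  have hsq : ∀ z ∈ Metric.ball c R, h z ^ 2 = φ z := by
    intro z hz
    rw [← hle z hz, hh, sq, ← Complex.exp_add, add_halves]
  -- `h` has positive real part where `φ` is close to `1`
  set Ω : Set ℂ := F '' Metric.ball (g c) d with hΩ
  have hΩmem : ∀ z ∈ Metric.ball c R, ‖φ z - 1‖ < 1 → z ∈ Ω := by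
    intro z hz h1
    refine ⟨g z, ?_, hFg z hz⟩
    have h2 : φ z - 1 = (g c - g z) / (a - g c) := by
      rw [hφ]; field_simp; ring
    rw [h2, norm_div, hacn, div_lt_one hdpos, ← dist_eq_norm] at h1
    rwa [Metric.mem_ball, dist_comm]
  have hΩsub : ∀ z ∈ Ω, z ∈ Metric.ball c R ∧ ‖φ z - 1‖ < 1 := by
    rintro _ ⟨x, hx, rfl⟩
    obtain ⟨z, hz, rfl⟩ := hsub hx
    rw [hFg z hz]
    refine ⟨hz, ?_⟩
    have h2 : φ z - 1 = (g c - g z) / (a - g c) := by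
      rw [hφ]; field_simp; ring
    rw [h2, norm_div, hacn, div_lt_one hdpos, ← dist_eq_norm, dist_comm]
    exact hx
  have hΩconn : IsPreconnected Ω := by
    refine (convex_ball (g c) d).isPreconnected.image F fun x hx => ?_
    obtain ⟨z, hz, rfl⟩ := hsub hx
    exact (hF z hz).continuousAt.continuousWithinAt
  have hΩc : c ∈ Ω := hΩmem c hcB (by simp [hφc])
  have hrepos : ∀ z ∈ Ω, 0 < (h z).re := by
    -- the real part does not vanish on the connected set `Ω`
    have hnz : ∀ z ∈ Ω, (h z).re ≠ 0 := by
      intro z hz h0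
      obtain ⟨hzB, hz1⟩ := hΩsub z hz
      have h3 : (φ z).re ≤ 0 := by
        rw [← hsq z hzB, sq, Complex.mul_re, h0]
        nlinarith [sq_nonneg (h z).im]
      have h4 := (Complex.abs_re_le_norm (φ z - 1)).trans_lt hz1
      rw [Complex.sub_re, Complex.one_re, abs_lt] at h4
      linarith [h4.1]
    have hcont : ContinuousOn (fun z => (h z).re) Ω :=
      Complex.continuous_re.comp_continuousOn (hhd.continuousOn.mono fun z hz => (hΩsub z hz).1)
    intro z hz
    by_contra hneg
    have hmem : (0 : ℝ) ∈ (fun z => (h z).re) '' Ω :=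
      (hΩconn.image _ hcont).Icc_subset ⟨z, hz, rfl⟩ ⟨c, hΩc, rfl⟩
        ⟨not_lt.1 hneg, by simp [hhc]⟩
    obtain ⟨w, hw, hw0⟩ := hmem
    exact hnz w hw hw0
  -- If `h z` were near -1, then `φ z = h z ^ 2` would be near 1 and `z` would lie in `Ω`, where `h`
  -- has positive real part. The constant works since `1/4 * (1/4 + 2) < 1`.
  have hfar : ∀ z ∈ Metric.ball c R, 1 / 4 ≤ ‖h z + 1‖ := by
    intro z hz
    by_contra hlt
    rw [not_le] at hlt
    have h1 : φ z - 1 = (h z + 1) * (h z + 1 - 2) := by rw [← hsq z hz]; ring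
    have h2 : ‖φ z - 1‖ < 1 := by
      rw [h1, norm_mul]
      have h3 : ‖h z + 1 - 2‖ ≤ ‖h z + 1‖ + 2 := by simpa using norm_sub_le (h z + 1) 2
      nlinarith [norm_nonneg (h z + 1), norm_nonneg (h z + 1 - 2)]
    have h3 := hrepos z (hΩmem z hz h2)
    have h4 := (Complex.abs_re_le_norm (h z + 1)).trans_lt hlt
    rw [Complex.add_re, Complex.one_re, abs_lt] at h4
    linarith [h4.2]
  have hne1 : ∀ z ∈ Metric.ball c R, h z + 1 ≠ 0 := fun z hz h0 => by
    have := hfar z hz; rw [h0, norm_zero] at this; norm_num at this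
  set v : ℂ → ℂ := fun z => (h z + 1)⁻¹ with hv
  have hvd : DifferentiableOn ℂ v (Metric.ball c R) := (hhd.add_const 1).inv hne1
  have hv4 : ∀ z ∈ Metric.ball c R, ‖v z‖ ≤ 4 := fun z hz => by
    rw [hv, norm_inv]
    exact (inv_anti₀ (by norm_num) (hfar z hz)).trans (by norm_num)
  have hvc : v c = 1 / 2 := by simp only [hv, hhc]; norm_num
  constructor
  · have hderiv : ‖deriv v c‖ = ‖deriv g c‖ / (8 * d) := by
      have hhat : HasDerivAt h (deriv h c) c :=
        (hhd.differentiableAt (Metric.isOpen_ball.mem_nhds hcB)).hasDerivAt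
      have h1 : HasDerivAt φ (-deriv g c / (a - g c)) c :=
        ((hgat c hcB).hasDerivAt.const_sub a).div_const _
      have h2 : HasDerivAt (fun z => h z ^ 2) (2 * deriv h c) c := by
        exact (hhat.fun_pow 2).congr_deriv (by rw [hhc]; norm_num)
      have h3 : HasDerivAt φ (2 * deriv h c) c := by
        refine h2.congr_of_eventuallyEq ?_
        filter_upwards [Metric.isOpen_ball.mem_nhds hcB] with z hz using (hsq z hz).symm
      have h4 : deriv h c = -deriv g c / (a - g c) / 2 := by
        rw [h1.unique h3]; ring
      have h5 : HasDerivAt v (-deriv h c / (h c + 1) ^ 2) c := (hhat.add_const 1).inv (hne1 c hcB)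
      rw [h5.deriv, h4, hhc, norm_div, norm_neg, norm_div, norm_div, norm_neg, hacn]
      norm_num
      field_simp
      norm_num
    -- Schwarz for `v`, using `4 + 1/2 ≤ 5`, gives `‖deriv g c‖ / (8 * d) ≤ 5 / R`: this is the 40.
    have h6 := Complex.norm_deriv_le_div_of_mapsTo_ball (f := v) (c := c) (R₁ := R) (R₂ := 5) hvd
      (fun z hz => by
        rw [mem_closedBall_iff_norm, hvc]
        refine (norm_sub_le _ _).trans ?_
        have := hv4 z hz
        have h7 : ‖(1 / 2 : ℂ)‖ = 1 / 2 := by norm_num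
        rw [h7]; linarith) hR
    rw [hderiv, div_le_div_iff₀ (by positivity) hR] at h6
    refine (Metric.ball_subset_ball ?_).trans hsub
    linarith
  · intro z hz
    have hzB : z ∈ Metric.ball c R := Metric.ball_subset_ball (by linarith) hz
    have h1 := norm_inv_le_of_norm_le_four hR hvd (fun z hz => inv_ne_zero (hne1 z hz)) hv4 hvc z hz
    rw [hv, norm_inv, inv_inv] at h1
    have h2 : ‖h z‖ ≤ Real.exp 10 + 1 := by
      have := norm_sub_le (h z + 1) 1
      rw [add_sub_cancel_right, norm_one] at this
      linarith
    have h3 : g z - g c = (a - g c) * (1 - h z ^ 2) := by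
      rw [hsq z hzB, hφ]; field_simp; ring
    rw [h3, norm_mul, hacn, mul_comm]
    have h4 : ‖1 - h z ^ 2‖ ≤ 1 + (Real.exp 10 + 1) ^ 2 := by
      refine (norm_sub_le _ _).trans ?_
      rw [norm_one, norm_pow]; gcongr
    exact mul_le_mul h4 hdle hdpos.le (by positivity)

/-! ### Finite iterates and invariance of the Julia and post-critical sets -/

namespace MeroDyn

variable {f : ℂ → ℂ}

theorem analyticAt_of_not_isPole (hf : MeromorphicNFOn f Set.univ) {z : ℂ} (hz : ¬ IsPole f z) :
    AnalyticAt ℂ f z :=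
  (hf (Set.mem_univ z)).meromorphicOrderAt_nonneg_iff_analyticAt.1 (not_lt.1 hz)

theorem isOpen_not_isPole (hf : MeromorphicNFOn f Set.univ) : IsOpen {z | ¬ IsPole f z} := by
  have : {z | ¬ IsPole f z} = {z | AnalyticAt ℂ f z} :=
    Set.ext fun z => ⟨analyticAt_of_not_isPole hf, fun h => not_lt.2 h.meromorphicOrderAt_nonneg⟩
  rw [this]
  exact isOpen_analyticAt ℂ f

theorem iterateFiniteAt_zero (z : ℂ) : IterateFiniteAt f 0 z := fun _ hk => absurd hk (Nat.not_lt_zero _)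

theorem iterateFiniteAt_add {m n : ℕ} {z : ℂ} :
    IterateFiniteAt f (m + n) z ↔ IterateFiniteAt f n z ∧ IterateFiniteAt f m (f^[n] z) := by
  constructor
  · refine fun h => ⟨fun k hk => h k (by omega), fun k hk => ?_⟩
    rw [← Function.iterate_add_apply]
    exact h (k + n) (by omega)
  · rintro ⟨h1, h2⟩ k hk
    rcases lt_or_ge k n with h | h
    · exact h1 k h
    · obtain ⟨j, rfl⟩ := Nat.exists_eq_add_of_le' h
      rw [Function.iterate_add_apply]
      exact h2 j (by omega)

theorem iterateFiniteAt_one {z : ℂ} : IterateFiniteAt f 1 z ↔ ¬ IsPole f z :=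
  ⟨fun h => h 0 one_pos, fun h k hk => by
    obtain rfl : k = 0 := by omega
    exact h⟩

theorem IterateFiniteAt.mono {m n : ℕ} {z : ℂ} (h : IterateFiniteAt f n z) (hmn : m ≤ n) :
    IterateFiniteAt f m z := fun k hk => h k (hk.trans_le hmn)

theorem IterateFiniteAt.analyticAt (hf : MeromorphicNFOn f Set.univ) {n : ℕ} {z : ℂ}
    (h : IterateFiniteAt f n z) : AnalyticAt ℂ f^[n] z := by
  induction n with
  | zero => exact analyticAt_id
  | succ n ih =>
    rw [add_comm, iterateFiniteAt_add, iterateFiniteAt_one] at h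
    rw [Function.iterate_succ']
    exact (analyticAt_of_not_isPole hf h.2).comp (ih h.1)

theorem deriv_iterate_add (hf : MeromorphicNFOn f Set.univ) {m n : ℕ} {z : ℂ}
    (h : IterateFiniteAt f (m + n) z) :
    deriv f^[m + n] z = deriv f^[m] (f^[n] z) * deriv f^[n] z := by
  rw [iterateFiniteAt_add] at h
  rw [Function.iterate_add]
  exact deriv_comp z (h.2.analyticAt hf).differentiableAt (h.1.analyticAt hf).differentiableAt

theorem apply_mem_postcriticalSet (hf : MeromorphicNFOn f Set.univ) {z : ℂ} (hz : ¬ IsPole f z)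
    (h : z ∈ postcriticalSet f) : f z ∈ postcriticalSet f := by
  have hopen := (isOpen_not_isPole hf).mem_nhds hz
  refine mem_closure_iff_frequently.2 (((analyticAt_of_not_isPole hf hz).continuousAt.tendsto.frequently
    (((mem_closure_iff_frequently.1 h).and_eventually hopen).mono ?_)))
  rintro w ⟨⟨n, s, hs, hfin, rfl⟩, hw⟩
  exact ⟨1 + n, s, hs, iterateFiniteAt_add.2 ⟨hfin, iterateFiniteAt_one.2 hw⟩,
    Function.iterate_add_apply f 1 n s⟩

theorem singularValues_subset_postcriticalSet : singularValues f ⊆ postcriticalSet f := fun s hs =>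
  subset_closure ⟨0, s, hs, iterateFiniteAt_zero s, rfl⟩

theorem isOpen_fatouSet : IsOpen (fatouSet f) :=
  isOpen_iff_forall_mem_open.2 fun _ ⟨U, hU, hzU, h⟩ => ⟨U, fun _ hw => ⟨U, hU, hw, h⟩, hU, hzU⟩

theorem isClosed_juliaSet : IsClosed (juliaSet f) := isOpen_fatouSet.isClosed_compl

theorem chordal_self (x : OnePoint ℂ) : chordal x x = 0 := by
  cases x using OnePoint.rec with
  | infty => rfl
  | coe z => show 2 * ‖z - z‖ / _ = 0; simp

/-- The Julia set is forward invariant. -/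
theorem apply_mem_juliaSet (hf : MeromorphicNFOn f Set.univ) {z : ℂ} (hz : ¬ IsPole f z)
    (h : z ∈ juliaSet f) : f z ∈ juliaSet f := by
  rintro ⟨U, hU, hzU, hfin, hnorm⟩
  refine h ⟨{w | ¬ IsPole f w} ∩ f ⁻¹' U, ?_, ⟨hz, hzU⟩, ?_, ?_⟩
  · refine ContinuousOn.isOpen_inter_preimage ?_ (isOpen_not_isPole hf) hU
    exact fun w hw => (analyticAt_of_not_isPole hf hw).continuousAt.continuousWithinAt
  · rintro w ⟨hw, hwU⟩ n
    rcases n with _ | n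
    · exact iterateFiniteAt_zero w
    · exact iterateFiniteAt_add.2 ⟨iterateFiniteAt_one.2 hw, hfin _ hwU n⟩
  · intro n
    by_cases hn : ∃ᶠ k in atTop, n k = 0
    -- If the identity occurs infinitely often, it is itself a constant subsequence. Otherwise
    -- almost all `n k` are positive, and normality of the shifted sequence at `f z` is pulled back
    -- by `f`; the truncation of `n k - 1` affects finitely many terms only.
    · obtain ⟨φ, hφ, hφ0⟩ := extraction_of_frequently_atTop hn
      refine ⟨φ, hφ, fun z => z, fun K _ _ ε hε => Eventually.of_forall fun k z _ => ?_⟩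
      simp only [hφ0 k, Function.iterate_zero, id]
      rw [chordal_self]; exact hε
    · rw [not_frequently] at hn
      obtain ⟨φ, hφ, g, hg⟩ := hnorm fun k => n k - 1
      refine ⟨φ, hφ, g ∘ f, fun K hK hKc ε hε => ?_⟩
      have hcont : ContinuousOn f K := fun w hw =>
        (analyticAt_of_not_isPole hf (hK hw).1).continuousAt.continuousWithinAt
      have h1 := hg (f '' K) (Set.image_subset_iff.2 fun w hw => (hK hw).2) (hKc.image_of_continuousOn hcont) ε hε
      filter_upwards [h1, hφ.tendsto_atTop.eventually hn] with k hk hnk w hw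
      have h2 := hk (f w) (Set.mem_image_of_mem f hw)
      obtain ⟨j, hj⟩ := Nat.exists_eq_succ_of_ne_zero hnk
      simp only [hj, Nat.succ_sub_one] at h2
      simpa only [hj, Function.iterate_succ_apply, Function.comp_apply] using h2

theorem iterate_mem_juliaSet (hf : MeromorphicNFOn f Set.univ) {n : ℕ} {z : ℂ}
    (hn : IterateFiniteAt f n z) (h : z ∈ juliaSet f) : f^[n] z ∈ juliaSet f := by
  induction n with
  | zero => exact h
  | succ n ih =>
    rw [add_comm, iterateFiniteAt_add, iterateFiniteAt_one] at hn
    rw [Function.iterate_succ_apply']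
    exact apply_mem_juliaSet hf hn.2 (ih hn.1)

theorem iterate_mem_postcriticalSet (hf : MeromorphicNFOn f Set.univ) {n : ℕ} {z : ℂ}
    (hn : IterateFiniteAt f n z) (h : z ∈ postcriticalSet f) : f^[n] z ∈ postcriticalSet f := by
  induction n with
  | zero => exact h
  | succ n ih =>
    rw [add_comm, iterateFiniteAt_add, iterateFiniteAt_one] at hn
    rw [Function.iterate_succ_apply']
    exact apply_mem_postcriticalSet hf hn.2 (ih hn.1)

/-! ### Lifting through `f` and inverse branches -/

/-- The set on which `f` is locally biholomorphic. -/
def regularSet (f : ℂ → ℂ) : Set ℂ := {z | ¬ IsPole f z ∧ deriv f z ≠ 0}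

theorem isOpen_regularSet (hf : MeromorphicNFOn f Set.univ) : IsOpen (regularSet f) := by
  have hc : ContinuousOn (deriv f) {z | ¬ IsPole f z} := fun z hz =>
    (analyticAt_of_not_isPole hf hz).deriv.continuousAt.continuousWithinAt
  exact hc.isOpen_inter_preimage (isOpen_not_isPole hf) isOpen_compl_singleton

theorem isLocalHomeomorph_restrict_regularSet (hf : MeromorphicNFOn f Set.univ) :
    IsLocalHomeomorph (fun z : regularSet f => f z) := by
  have h1 : IsLocalHomeomorphOn f (regularSet f) := fun z hz => by
    have hs : HasStrictDerivAt f (deriv f z) z := (analyticAt_of_not_isPole hf hz.1).hasStrictDerivAt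
    have hs' := hs.hasStrictFDerivAt_equiv hz.2
    exact ⟨hs'.toOpenPartialHomeomorph f, hs'.mem_toOpenPartialHomeomorph_source, rfl⟩
  have h2 := (isOpen_regularSet hf).isOpenEmbedding_subtypeVal.isLocalHomeomorph
  exact isLocalHomeomorph_iff_isLocalHomeomorphOn_univ.2
    (h1.comp h2.isLocalHomeomorphOn fun x _ => x.2)

/-- A partial lift of a path either has a cluster point in the regular set, or the path ends at a
singular value. -/
theorem exists_mapClusterPt_lift (hf : MeromorphicNFOn f Set.univ) {γ : ℝ → ℂ} {T : ℝ} (hT : 0 < T)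
    (hγ : ContinuousWithinAt γ (Set.Ico 0 T) T) (hγT : γ T ∉ singularValues f)
    {z : ℝ → regularSet f} (hz : ContinuousOn z (Set.Ico 0 T))
    (hzl : ∀ t ∈ Set.Ico 0 T, f (z t) = γ t) : ∃ x, MapClusterPt x (𝓝[<] T) z := by
  have hIco : Set.Ico 0 T ∈ 𝓝[<] T := Ico_mem_nhdsLT hT
  have hγ' : Tendsto γ (𝓝[<] T) (𝓝 (γ T)) := hγ.mono_left (nhdsWithin_le_iff.2 hIco)
  have hfz : Tendsto (fun t => f (z t)) (𝓝[<] T) (𝓝 (γ T)) :=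
    hγ'.congr' (by filter_upwards [hIco] with t ht using (hzl t ht).symm)
  by_cases hinf : Tendsto (fun t => ‖(z t : ℂ)‖) (𝓝[<] T) atTop
  · exfalso
    apply hγT
    right
    -- The lift escapes to `∞`, so reparametrizing `[0, T)` by `[0, ∞)`, constantly on negative
    -- times, exhibits `γ T` as an asymptotic value.
    have hσ : Tendsto (fun s : ℝ => T * (max s 0 / (1 + max s 0))) atTop (𝓝[<] T) := by
      refine tendsto_nhdsWithin_iff.2 ⟨?_, ?_⟩
      · have h1 : Tendsto (fun s : ℝ => T * (1 - (1 + s)⁻¹)) atTop (𝓝 (T * (1 - 0))) :=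
          (tendsto_const_nhds.sub (tendsto_inv_atTop_zero.comp
            (tendsto_atTop_add_const_left _ _ tendsto_id))).const_mul T
        rw [sub_zero, mul_one] at h1
        refine h1.congr' ?_
        filter_upwards [eventually_ge_atTop 0] with s hs
        rw [max_eq_left hs]
        have : (1 + s) ≠ 0 := by positivity
        field_simp
        ring
      · refine Eventually.of_forall fun s => ?_
        have h0 : 0 ≤ max s 0 := le_max_right _ _
        have h2 : max s 0 / (1 + max s 0) < 1 := by rw [div_lt_one (by positivity)]; linarith
        exact (mul_lt_mul_of_pos_left h2 hT).trans_eq (mul_one T)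
    have hσI : ∀ s : ℝ, T * (max s 0 / (1 + max s 0)) ∈ Set.Ico 0 T := fun s => by
      have h0 : 0 ≤ max s 0 := le_max_right _ _
      have h2 : max s 0 / (1 + max s 0) < 1 := by rw [div_lt_one (by positivity)]; linarith
      exact ⟨by positivity, (mul_lt_mul_of_pos_left h2 hT).trans_eq (mul_one T)⟩
    have hσc : Continuous fun s : ℝ => T * (max s 0 / (1 + max s 0)) := by
      refine continuous_const.mul (Continuous.div (by fun_prop) (by fun_prop) fun s => ?_)
      have h0 : 0 ≤ max s 0 := le_max_right _ _
      positivity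
    exact ⟨fun s => z (T * (max s 0 / (1 + max s 0))),
      continuous_subtype_val.comp (hz.comp_continuous hσc hσI), hinf.comp hσ,
      Eventually.of_forall fun s => (z _).2.1, hfz.comp hσ⟩
  · rw [tendsto_atTop] at hinf
    push Not at hinf
    obtain ⟨M, hM⟩ := hinf
    have hfr : ∃ᶠ t in 𝓝[<] T, (z t : ℂ) ∈ Metric.closedBall (0 : ℂ) M :=
      hM.mono fun t ht => by simpa using ht.le
    obtain ⟨x, -, hx⟩ := (isCompact_closedBall (0 : ℂ) M).exists_mapClusterPt_of_frequently hfr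
    have hxp : ¬ IsPole f x := by
      intro hpole
      have h1 : ∀ᶠ u in 𝓝[≠] x, ‖γ T‖ + 1 < ‖f u‖ :=
        (tendsto_norm_cobounded_atTop.comp (tendsto_cobounded_of_meromorphicOrderAt_neg hpole)).eventually
          (eventually_gt_atTop _)
      have h2 : ∀ᶠ t in 𝓝[<] T, ‖f (z t)‖ < ‖γ T‖ + 1 :=
        hfz.norm.eventually (gt_mem_nhds (by linarith))
      obtain ⟨t, ht1, ht2⟩ := ((hx.frequently (eventually_nhdsWithin_iff.1 h1)).and_eventually h2).exists
      exact absurd (ht1 fun h => (z t).2.1 (Set.mem_singleton_iff.1 h ▸ hpole)) (not_lt.2 ht2.le)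
    have hfx : f x = γ T := by
      have h1 : MapClusterPt (f x) (𝓝[<] T) (f ∘ fun t => (z t : ℂ)) :=
        hx.continuousAt_comp (analyticAt_of_not_isPole hf hxp).continuousAt
      by_contra hne
      exact h1.neBot.ne
        (le_bot_iff.1 ((inf_le_inf_left _ hfz).trans (disjoint_nhds_nhds.2 hne).le_bot))
    have hxr : x ∈ regularSet f := ⟨hxp, fun h0 => hγT (Or.inl ⟨x, hxp, h0, hfx⟩)⟩
    refine ⟨⟨x, hxr⟩, mapClusterPt_iff_frequently.2 fun s hs => ?_⟩
    rw [nhds_subtype, mem_comap] at hs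
    obtain ⟨u, hu, hus⟩ := hs
    exact (hx.frequently hu).mono fun t ht => hus ht

/-- A holomorphic map from a disk into the complement of the singular values lifts through `f`. -/
theorem exists_lift_ball (hf : MeromorphicNFOn f Set.univ) {h : ℂ → ℂ} {w : ℂ} {δ : ℝ} (hδ : 0 < δ)
    (hh : DifferentiableOn ℂ h (Metric.ball w δ))
    (hs : ∀ z ∈ Metric.ball w δ, h z ∉ singularValues f) {y : ℂ} (hy : ¬ IsPole f y)
    (hyw : f y = h w) :
    ∃ G : ℂ → ℂ, DifferentiableOn ℂ G (Metric.ball w δ) ∧ G w = y ∧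
      ∀ z ∈ Metric.ball w δ, ¬ IsPole f (G z) ∧ f (G z) = h z := by
  have hwB : w ∈ Metric.ball w δ := Metric.mem_ball_self hδ
  have hyr : y ∈ regularSet f := ⟨hy, fun h0 => hs w hwB (Or.inl ⟨y, hy, h0, hyw⟩)⟩
  have hloc := isLocalHomeomorph_restrict_regularSet hf
  have hseg : ∀ a ∈ Metric.ball w δ, ∀ t ∈ Set.Icc (0 : ℝ) 1, w + t * (a - w) ∈ Metric.ball w δ := by
    intro a ha t ht
    rw [Metric.mem_ball, dist_eq_norm] at ha ⊢
    rw [add_sub_cancel_left, norm_mul, Complex.norm_real, Real.norm_eq_abs, abs_of_nonneg ht.1]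
    exact (mul_le_of_le_one_left (norm_nonneg _) ht.2).trans_lt ha
  have hlift : ∀ a : Metric.ball w δ, ∃ z : ℝ → regularSet f, ContinuousOn z (Set.Icc 0 1) ∧
      z 0 = ⟨y, hyr⟩ ∧ ∀ t ∈ Set.Icc (0 : ℝ) 1, f (z t) = h (w + t * (a - w)) := by
    intro a
    have hγ : ContinuousOn (fun t : ℝ => h (w + t * (a - w))) (Set.Icc 0 1) :=
      hh.continuousOn.comp (by fun_prop) (hseg a a.2)
    refine hloc.exists_lift_Icc hγ (by simpa using hyw) fun T hT0 hT1 z hz hzl => ?_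
    refine exists_mapClusterPt_lift hf hT0 (γ := fun t : ℝ => h (w + t * (a - w)))
      ((hγ T ⟨hT0.le, hT1⟩).mono fun t ht => ⟨ht.1, ht.2.le.trans hT1⟩)
      (hs _ (hseg a a.2 T ⟨hT0.le, hT1⟩)) hz hzl
  choose Z hZc hZ0 hZl using hlift
  have hcont : Continuous fun ta : unitInterval × Metric.ball w δ => Z ta.2 ta.1 := by
    have hF : Continuous fun ta : unitInterval × Metric.ball w δ =>
        h (w + ((ta.1 : ℝ) : ℂ) * (ta.2 - w)) :=
      hh.continuousOn.comp_continuous (by fun_prop) fun ta => hseg ta.2 ta.2.2 ta.1 ta.1.2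
    -- The lifts of the radial segments depend continuously on the endpoint `a`, so their values at
    -- time 1 form a continuous lift of `h`.
    refine hloc.continuous_lift (T2Space.isSeparatedMap _) ⟨_, hF⟩ ?_ ?_ ?_
    · ext ta
      exact hZl ta.2 ta.1 ta.1.2
    · have : (fun a : Metric.ball w δ => Z a ((0 : unitInterval) : ℝ)) = fun _ => ⟨y, hyr⟩ :=
        funext fun a => hZ0 a
      show Continuous fun a : Metric.ball w δ => Z a ((0 : unitInterval) : ℝ)
      rw [this]; exact continuous_const
    · exact fun a => (hZc a).comp_continuous continuous_subtype_val fun t => t.2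
  classical
  set G : ℂ → ℂ := fun z => if hz : z ∈ Metric.ball w δ then (Z ⟨z, hz⟩ 1 : ℂ) else 0 with hG
  have hGz : ∀ z (hz : z ∈ Metric.ball w δ), G z = Z ⟨z, hz⟩ 1 := fun z hz => dif_pos hz
  have hGr : ∀ z ∈ Metric.ball w δ, G z ∈ regularSet f := fun z hz => by
    rw [hGz z hz]; exact (Z ⟨z, hz⟩ 1).2
  have hGl : ∀ z ∈ Metric.ball w δ, f (G z) = h z := fun z hz => by
    rw [hGz z hz, hZl ⟨z, hz⟩ 1 ⟨zero_le_one, le_rfl⟩]; simp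
  have hGc : ContinuousOn G (Metric.ball w δ) := by
    rw [continuousOn_iff_continuous_domRestrict]
    have : (Metric.ball w δ).domRestrict G = fun a => (Z a ((1 : unitInterval) : ℝ) : ℂ) :=
      funext fun a => hGz a a.2
    rw [this]
    exact continuous_subtype_val.comp (hcont.comp (Continuous.prodMk_right (1 : unitInterval)))
  refine ⟨G, fun z hz => ?_, ?_, fun z hz => ⟨(hGr z hz).1, hGl z hz⟩⟩
  · have hsd : HasStrictDerivAt f (deriv f (G z)) (G z) :=
      (analyticAt_of_not_isPole hf (hGr z hz).1).hasStrictDerivAt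
    have hnhds := Metric.isOpen_ball.mem_nhds hz
    have hGat : ContinuousAt G z := hGc.continuousAt hnhds
    have hinv := hsd.to_localInverse (hGr z hz).2
    -- Locally `G` is a holomorphic local inverse of `f` composed with `h`, hence differentiable.
    have hev : (fun u => hsd.localInverse f _ _ (hGr z hz).2 (h u)) =ᶠ[𝓝 z] G := by
      have h1 := (hsd.hasStrictFDerivAt_equiv (hGr z hz).2).eventually_left_inverse
      filter_upwards [hGat.eventually h1, hnhds] with u hu huB
      rw [← hGl u huB]
      exact hu
    have hd : DifferentiableAt ℂ (hsd.localInverse f _ _ (hGr z hz).2) (h z) := by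
      rw [← hGl z hz]; exact hinv.hasDerivAt.differentiableAt
    exact ((hd.comp z (hh.differentiableAt hnhds)).congr_of_eventuallyEq hev.symm).differentiableWithinAt
  · rw [hGz w hwB]
    have hconst : ∀ t ∈ Set.Icc (0 : ℝ) 1, Z ⟨w, hwB⟩ t = ⟨y, hyr⟩ := by
      have := (T2Space.isSeparatedMap (fun z : regularSet f => f z)).eqOn_of_comp_eqOn
        hloc.isLocallyInjective (isPreconnected_Icc (a := (0 : ℝ)) (b := 1)) (hZc ⟨w, hwB⟩)
        (continuousOn_const (c := ⟨y, hyr⟩)) (fun t ht => by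
          simp only [Function.comp]
          rw [hZl ⟨w, hwB⟩ t ht, hyw]; simp) (a := 0) ⟨le_rfl, zero_le_one⟩ (hZ0 _)
      exact this
    rw [hconst 1 ⟨zero_le_one, le_rfl⟩]

/-- Holomorphic inverse branches of the iterates on disks that avoid the post-critical set. -/
theorem exists_inverse_branch (hf : MeromorphicNFOn f Set.univ) {δ : ℝ} (hδ : 0 < δ) {w : ℂ}
    (hw : ∀ z ∈ Metric.ball w δ, z ∉ postcriticalSet f) {m : ℕ} {y : ℂ}
    (hm : IterateFiniteAt f m y) (hyw : f^[m] y = w) :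
    ∃ G : ℂ → ℂ, DifferentiableOn ℂ G (Metric.ball w δ) ∧ G w = y ∧
      ∀ z ∈ Metric.ball w δ, IterateFiniteAt f m (G z) ∧ f^[m] (G z) = z := by
  induction m generalizing y with
  | zero =>
    exact ⟨id, differentiableOn_id, hyw.symm, fun z _ => ⟨iterateFiniteAt_zero _, rfl⟩⟩
  | succ m ih =>
    rw [iterateFiniteAt_add, iterateFiniteAt_one] at hm
    obtain ⟨H, hHd, hHw, hH⟩ := ih hm.2 hyw
    -- A singular value `H z` would have `z = f^[m] (H z)` on its forward orbit, so `z` would be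
    -- post-critical.
    obtain ⟨G, hGd, hGw, hG⟩ := exists_lift_ball hf hδ hHd (fun z hz hsing => hw z hz (by
      have := iterate_mem_postcriticalSet hf (hH z hz).1 (singularValues_subset_postcriticalSet hsing)
      rwa [(hH z hz).2] at this)) hm.1 hHw.symm
    refine ⟨G, hGd, hGw, fun z hz => ⟨iterateFiniteAt_add.2 ⟨iterateFiniteAt_one.2 (hG z hz).1, ?_⟩, ?_⟩⟩
    · show IterateFiniteAt f m (f (G z))
      rw [(hG z hz).2]; exact (hH z hz).1
    · rw [Function.iterate_succ_apply, (hG z hz).2, (hH z hz).2]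

/-! ### From bounded derivatives to normality -/

/-- If the derivatives of the first `m` iterates are bounded at a point of the Julia set, these
iterates are defined and have bounded oscillation on a disk of uniform size. -/
theorem exists_ball_bounded_oscillation (hf : MeromorphicNFOn f Set.univ) {δ : ℝ} (hδ : 0 < δ)
    (hJP : ∀ z ∈ juliaSet f, ∀ w ∈ postcriticalSet f, δ ≤ dist z w) {C : ℝ} (hC : 0 < C) :
    ∃ r > (0 : ℝ), ∃ K : ℝ, ∀ m : ℕ, ∀ y ∈ juliaSet f, IterateFiniteAt f m y →
      (∀ n ≤ m, ‖deriv f^[n] y‖ ≤ C) → ∀ u ∈ Metric.ball y r, IterateFiniteAt f m u ∧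
        ∀ n ≤ m, ‖f^[n] u - f^[n] y‖ ≤ K := by
  -- Since the inverse branch has derivative at least `C⁻¹` in modulus, Koebe puts the disk of
  -- radius `ρ` inside its image.
  set ρ : ℝ := δ / (40 * C) with hρ
  have hρ0 : 0 < ρ := by positivity
  refine ⟨ρ / 2, by positivity, (1 + (Real.exp 10 + 1) ^ 2) * (ρ * C), ?_⟩
  intro m y hy hm hder
  set w := f^[m] y with hw
  have hwB : w ∈ Metric.ball w δ := Metric.mem_ball_self hδ
  have hwJ : w ∈ juliaSet f := iterate_mem_juliaSet hf hm hy
  obtain ⟨G, hGd, hGw, hG⟩ := exists_inverse_branch hf hδ (w := w) (fun z hz hzP => by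
    have := hJP w hwJ z hzP
    rw [Metric.mem_ball, dist_comm] at hz
    linarith) hm rfl
  have hprod : deriv f^[m] y * deriv G w = 1 := by
    have h1 : HasDerivAt (f^[m] ∘ G) (deriv f^[m] (G w) * deriv G w) w := by
      refine HasDerivAt.comp w ?_ (hGd.differentiableAt (Metric.isOpen_ball.mem_nhds hwB)).hasDerivAt
      exact ((hG w hwB).1.analyticAt hf).differentiableAt.hasDerivAt
    have h2 : HasDerivAt (f^[m] ∘ G) 1 w := by
      refine (hasDerivAt_id w).congr_of_eventuallyEq ?_
      filter_upwards [Metric.isOpen_ball.mem_nhds hwB] with z hz using (hG z hz).2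
    rw [hGw] at h1
    exact h1.unique h2
  have hG' : C⁻¹ ≤ ‖deriv G w‖ := by
    have h1 : ‖deriv f^[m] y‖ * ‖deriv G w‖ = 1 := by rw [← norm_mul, hprod, norm_one]
    have h2 := hder m le_rfl
    rw [inv_le_iff_one_le_mul₀' hC, ← h1]
    gcongr
  have hsub : Metric.ball y ρ ⊆ G '' Metric.ball w δ := by
    have h1 := (koebe_distortion hδ hGd (F := f^[m])
      (fun z hz => ((hG z hz).1.analyticAt hf).differentiableAt) (fun z hz => (hG z hz).2)).1
    rw [hGw] at h1
    refine (Metric.ball_subset_ball ?_).trans h1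
    have h3 : ρ = δ * C⁻¹ / 40 := by rw [hρ]; field_simp
    rw [h3]; gcongr
  have hfin : ∀ u ∈ Metric.ball y ρ, IterateFiniteAt f m u := fun u hu => by
    obtain ⟨ζ, hζ, rfl⟩ := hsub hu
    exact (hG ζ hζ).1
  intro u hu
  refine ⟨hfin u (Metric.ball_subset_ball (by linarith) hu), fun n hn => ?_⟩
  obtain ⟨j, rfl⟩ := Nat.exists_eq_add_of_le' hn
  -- On the disk of radius `ρ`, `f^[n]` has the holomorphic left inverse `G ∘ f^[j]`, where `m = j +
  -- n`, so the distortion bound applies to it.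
  have h4 := (koebe_distortion hρ0 (g := f^[n]) (F := G ∘ f^[j]) (c := y)
    (fun v hv => (((hfin v hv).mono hn).analyticAt hf).differentiableAt.differentiableWithinAt)
    (fun v hv => by
      obtain ⟨ζ, hζ, rfl⟩ := hsub hv
      have h5 := hG ζ hζ
      rw [iterateFiniteAt_add, Function.iterate_add_apply] at h5
      refine DifferentiableAt.comp _ ?_ (h5.1.2.analyticAt hf).differentiableAt
      rw [h5.2]
      exact hGd.differentiableAt (Metric.isOpen_ball.mem_nhds hζ))
    (fun v hv => by
      obtain ⟨ζ, hζ, rfl⟩ := hsub hv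
      rw [Function.comp_apply, ← Function.iterate_add_apply, (hG ζ hζ).2])).2 u hu
  refine h4.trans ?_
  gcongr
  exact hder n hn

theorem chordal_coe_le (z w : ℂ) : chordal (z : OnePoint ℂ) (w : OnePoint ℂ) ≤ 2 * ‖z - w‖ := by
  show 2 * ‖z - w‖ / (√(1 + ‖z‖ ^ 2) * √(1 + ‖w‖ ^ 2)) ≤ 2 * ‖z - w‖
  refine div_le_self (by positivity) (one_le_mul_of_one_le_of_one_le ?_ ?_) <;>
  · rw [Real.one_le_sqrt]
    linarith [sq_nonneg ‖z‖, sq_nonneg ‖w‖]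

theorem chordal_coe_infty_le {z : ℂ} (hz : 0 < ‖z‖) :
    chordal (z : OnePoint ℂ) OnePoint.infty ≤ 2 / ‖z‖ := by
  show 2 / √(1 + ‖z‖ ^ 2) ≤ 2 / ‖z‖
  gcongr
  exact Real.le_sqrt_of_sq_le (by linarith)

/-- If all iterates are defined and have uniformly bounded oscillation on a disk, its centre
belongs to the Fatou set. -/
theorem mem_fatouSet_of_bounded_oscillation (hf : MeromorphicNFOn f Set.univ) {x : ℂ} {r K : ℝ}
    (hr : 0 < r) (hfin : ∀ n, ∀ u ∈ Metric.ball x r, IterateFiniteAt f n u)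
    (hK : ∀ n, ∀ u ∈ Metric.ball x r, ‖f^[n] u - f^[n] x‖ ≤ K) : x ∈ fatouSet f := by
  have hK0 : 0 ≤ K := (norm_nonneg _).trans (hK 0 x (Metric.mem_ball_self hr))
  have hsub : Metric.closedBall x (r / 2) ⊆ Metric.ball x r :=
    Metric.closedBall_subset_ball (by linarith)
  refine ⟨Metric.ball x (r / 2), Metric.isOpen_ball, Metric.mem_ball_self (by positivity),
    fun w hw n => hfin n w (hsub (Metric.ball_subset_closedBall hw)), fun n => ?_⟩
  -- If the values at the centre tend to `∞`, bounded oscillation forces chordal convergence to `∞`.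
  -- Otherwise a subsequence is bounded and, by Cauchy's estimate, equi-Lipschitz, so Arzelà–Ascoli
  -- applies.
  by_cases hlim : Tendsto (fun k => ‖f^[n k] x‖) atTop atTop
  · refine ⟨id, strictMono_id, fun _ => OnePoint.infty, fun S hS _ ε hε => ?_⟩
    filter_upwards [hlim.eventually (eventually_gt_atTop (K + 2 / ε))] with k hk z hz
    have h1 := hK (n k) z (hsub (Metric.ball_subset_closedBall (hS hz)))
    have h2 : 2 / ε < ‖f^[n k] z‖ := by
      have := norm_sub_norm_le (f^[n k] x) (f^[n k] z)
      rw [norm_sub_rev] at this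
      linarith
    have h3 : 0 < ‖f^[n k] z‖ := lt_trans (by positivity) h2
    refine (chordal_coe_infty_le h3).trans_lt ?_
    rw [div_lt_iff₀ hε] at h2
    rw [div_lt_iff₀ h3]
    linarith
  · rw [tendsto_atTop] at hlim
    push Not at hlim
    obtain ⟨M, hM⟩ := hlim
    obtain ⟨φ, hφ, hφM⟩ := extraction_of_frequently_atTop hM
    set X := Metric.closedBall x (r / 2)
    have : CompactSpace X := isCompact_iff_compactSpace.1 (isCompact_closedBall x (r / 2))
    have hdiff : ∀ n, DifferentiableOn ℂ f^[n] (Metric.ball x r) := fun n u hu =>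
      ((hfin n u hu).analyticAt hf).differentiableAt.differentiableWithinAt
    have hlip : ∀ n, LipschitzOnWith (4 * K / r).toNNReal f^[n] X := by
      intro n
      refine (convex_closedBall x (r / 2)).lipschitzOnWith_of_nnnorm_deriv_le (𝕜 := ℂ)
        (fun u hu => (hdiff n).differentiableAt (Metric.isOpen_ball.mem_nhds (hsub hu))) fun u hu => ?_
      have hb : Metric.ball u (r / 2) ⊆ Metric.ball x r :=
        Metric.ball_subset_ball' (by linarith [Metric.mem_closedBall.1 hu])
      rw [← NNReal.coe_le_coe, coe_nnnorm, Real.coe_toNNReal _ (by positivity)]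
      refine (Complex.norm_deriv_le_div_of_mapsTo_ball (R₁ := r / 2) (R₂ := 2 * K)
        ((hdiff n).mono hb) (fun v hv => ?_) (by positivity)).trans_eq (by ring)
      rw [mem_closedBall_iff_norm]
      have h1 := hK n v (hb hv)
      have h2 := hK n u (hsub hu)
      rw [norm_sub_rev] at h2
      have h3 := norm_add_le (f^[n] v - f^[n] x) (f^[n] x - f^[n] u)
      rw [sub_add_sub_cancel] at h3
      linarith
    set F : ℕ → BoundedContinuousFunction X ℂ := fun k =>
      BoundedContinuousFunction.mkOfCompact
        ⟨X.domRestrict f^[n (φ k)], (hlip (n (φ k))).continuousOn.domRestrict⟩ with hF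
    have hFapp : ∀ k (u : X), F k u = f^[n (φ k)] u := fun k u => rfl
    have hcomp : IsCompact (closure (Set.range F)) := by
      refine BoundedContinuousFunction.arzela_ascoli (Metric.closedBall (0 : ℂ) (M + K))
        (isCompact_closedBall _ _) _ ?_ ?_
      · rintro _ u ⟨k, rfl⟩
        rw [hFapp, mem_closedBall_zero_iff]
        have h1 := hK (n (φ k)) u (hsub u.2)
        have h2 := hφM k
        have h3 := norm_sub_norm_le (f^[n (φ k)] u) (f^[n (φ k)] x)
        linarith
      · refine (LipschitzWith.uniformEquicontinuous _ (4 * K / r).toNNReal ?_).equicontinuous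
        rintro ⟨_, k, rfl⟩
        exact (hlip (n (φ k))).to_restrict
    obtain ⟨g, -, ψ, hψ, hlimg⟩ := hcomp.tendsto_subseq fun k => subset_closure (Set.mem_range_self k)
    classical
    refine ⟨φ ∘ ψ, hφ.comp hψ, fun z => if hz : z ∈ X then (g ⟨z, hz⟩ : OnePoint ℂ) else
      OnePoint.infty, fun S hS _ ε hε => ?_⟩
    filter_upwards [(Metric.tendsto_atTop'.1 hlimg (ε / 2) (by positivity)).choose_spec |>
      fun h => (eventually_gt_atTop _).mono h] with k hk z hz
    have hzX : z ∈ X := Metric.ball_subset_closedBall (hS hz)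
    rw [dif_pos hzX]
    refine (chordal_coe_le _ _).trans_lt ?_
    have h1 := (BoundedContinuousFunction.dist_coe_le_dist (f := F (ψ k)) (g := g) ⟨z, hzX⟩).trans_lt hk
    rw [hFapp, dist_eq_norm] at h1
    simp only [Function.comp_apply]
    linarith

/-- The derivatives along long orbits that start in a bounded part of the Julia set cannot stay
bounded. -/
theorem exists_forall_exists_lt_norm_deriv (hf : MeromorphicNFOn f Set.univ) {δ : ℝ} (hδ : 0 < δ)
    (hJP : ∀ z ∈ juliaSet f, ∀ w ∈ postcriticalSet f, δ ≤ dist z w) {C : ℝ} (hC : 0 < C) (R : ℝ) :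
    ∃ N : ℕ, ∀ m ≥ N, ∀ y ∈ juliaSet f, ‖y‖ ≤ R → IterateFiniteAt f m y →
      ∃ n ≤ m, C < ‖deriv f^[n] y‖ := by
  -- Failure gives points `y N` with bounded derivatives up to times `m N ≥ N`. Their limit `x` in
  -- the Julia set inherits a disk on which all iterates are finite with oscillation at most `2 *
  -- K`.
  by_contra! hcon
  choose m hm y hyJ hyR hfin hder using hcon
  obtain ⟨x, -, φ, hφ, hx⟩ := (isCompact_closedBall (0 : ℂ) R).tendsto_subseq (x := y)
    fun N => mem_closedBall_zero_iff.2 (hyR N)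
  have hxJ : x ∈ juliaSet f := isClosed_juliaSet.mem_of_tendsto hx (Eventually.of_forall fun k => hyJ _)
  obtain ⟨r, hr, K, hrK⟩ := exists_ball_bounded_oscillation hf hδ hJP hC
  have key : ∀ n, ∃ z, Metric.ball x (r / 2) ⊆ Metric.ball z r ∧
      ∀ u ∈ Metric.ball z r, IterateFiniteAt f n u ∧ ‖f^[n] u - f^[n] z‖ ≤ K := by
    intro n
    obtain ⟨k, hk1, hk2⟩ := ((hx.eventually (Metric.ball_mem_nhds x (half_pos hr))).and
      (eventually_ge_atTop n)).exists
    have hnm : n ≤ m (φ k) := hk2.trans ((hφ.id_le k).trans (hm _))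
    refine ⟨y (φ k), Metric.ball_subset_ball' ?_, fun u hu => ?_⟩
    · have : dist (y (φ k)) x < r / 2 := hk1
      rw [dist_comm]; linarith
    · obtain ⟨h1, h2⟩ := hrK _ _ (hyJ (φ k)) (hfin _) (hder _) u hu
      exact ⟨h1.mono hnm, h2 n hnm⟩
  refine hxJ (mem_fatouSet_of_bounded_oscillation hf (half_pos hr) (K := 2 * K) ?_ ?_)
  · intro n u hu
    obtain ⟨z, hz, hzu⟩ := key n
    exact (hzu u (hz hu)).1
  · intro n u hu
    obtain ⟨z, hz, hzu⟩ := key n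
    have h1 := (hzu u (hz hu)).2
    have h2 := (hzu x (hz (Metric.mem_ball_self (half_pos hr)))).2
    rw [norm_sub_rev] at h2
    have h3 := norm_add_le (f^[n] u - f^[n] z) (f^[n] z - f^[n] x)
    rw [sub_add_sub_cancel] at h3
    linarith

/-! ### Expansion from returns to a disk -/

theorem norm_deriv_iterate_add (hf : MeromorphicNFOn f Set.univ) {m n : ℕ} {z : ℂ}
    (h : IterateFiniteAt f (m + n) z) :
    ‖deriv f^[m + n] z‖ = ‖deriv f^[m] (f^[n] z)‖ * ‖deriv f^[n] z‖ := by
  rw [deriv_iterate_add hf h, norm_mul]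

theorem pow_le_norm_deriv_iterate (hf : MeromorphicNFOn f Set.univ) {b : ℝ} (hb : 0 ≤ b) {n : ℕ}
    {z : ℂ} (hn : IterateFiniteAt f n z)
    (hlow : ∀ k < n, b ≤ ‖deriv f (f^[k] z)‖) : b ^ n ≤ ‖deriv f^[n] z‖ := by
  induction n with
  | zero => simp
  | succ n ih =>
    have h1 := ih (hn.mono n.le_succ) fun k hk => hlow k (hk.trans n.lt_succ_self)
    rw [add_comm] at hn
    rw [add_comm n 1, norm_deriv_iterate_add hf hn, pow_add, pow_one, Function.iterate_one]
    exact mul_le_mul (hlow n n.lt_succ_self) h1 (by positivity) (norm_nonneg _)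

/-- The bounds on the derivative that the rapid growth condition provides: a lower bound on the
whole Julia set, and expansion at the points that are mapped outside a disk. -/
structure DerivLowerBound (f : ℂ → ℂ) (b R : ℝ) : Prop where
  pos : 0 < b
  le_one : b ≤ 1
  le_norm_deriv : ∀ z ∈ juliaSet f, ¬ IsPole f z → b ≤ ‖deriv f z‖
  two_le_norm_deriv : ∀ z ∈ juliaSet f, ¬ IsPole f z → R ≤ ‖f z‖ → 2 ≤ ‖deriv f z‖

/-- The factor `1 + ‖z‖ ^ α` is at least 1 and can be dropped; then `R` is chosen with `R ^ α₂ ≥ 2 *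
κ`. -/
theorem HasRapidDerivativeGrowth.exists_derivLowerBound {α : ℝ}
    (h : HasRapidDerivativeGrowth f α) : ∃ b R, DerivLowerBound f b R := by
  obtain ⟨α₂, hα₂, κ, hκ, hbound⟩ := h
  have hα₂' : 0 < α₂ := (le_max_left _ _).trans_lt hα₂
  have hlim : Tendsto (fun R : ℝ => R ^ α₂) atTop atTop := tendsto_rpow_atTop hα₂'
  obtain ⟨R, hR, hR0⟩ := ((hlim.eventually (eventually_ge_atTop (2 * κ))).and
    (eventually_ge_atTop 0)).exists
  have hge : ∀ z ∈ juliaSet f, ¬ IsPole f z → κ⁻¹ * (1 + ‖f z‖ ^ α₂) ≤ ‖deriv f z‖ := by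
    intro z hz hp
    refine le_trans ?_ (hbound z hz hp)
    have h1 : 0 ≤ ‖z‖ ^ α := Real.rpow_nonneg (norm_nonneg _) _
    have h2 : 0 ≤ ‖f z‖ ^ α₂ := Real.rpow_nonneg (norm_nonneg _) _
    have h3 : κ⁻¹ ≤ κ⁻¹ * (1 + ‖z‖ ^ α) := le_mul_of_one_le_right (by positivity) (by linarith)
    exact mul_le_mul_of_nonneg_right h3 (by positivity)
  refine ⟨min κ⁻¹ 1, R, by positivity, min_le_right _ _, fun z hz hp => ?_, fun z hz hp hzR => ?_⟩
  · refine (min_le_left _ _).trans (le_trans ?_ (hge z hz hp))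
    have h2 : 0 ≤ ‖f z‖ ^ α₂ := Real.rpow_nonneg (norm_nonneg _) _
    exact le_mul_of_one_le_right (by positivity) (by linarith)
  · refine le_trans ?_ (hge z hz hp)
    have h2 : R ^ α₂ ≤ ‖f z‖ ^ α₂ := Real.rpow_le_rpow hR0 hzR hα₂'.le
    rw [← div_eq_inv_mul, le_div_iff₀ hκ]
    linarith

namespace DerivLowerBound

variable {b R : ℝ} (h : DerivLowerBound f b R) (hf : MeromorphicNFOn f Set.univ)
include h hf

theorem pow_le {n : ℕ} {z : ℂ} (hz : z ∈ juliaSet f) (hn : IterateFiniteAt f n z) :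
    b ^ n ≤ ‖deriv f^[n] z‖ :=
  pow_le_norm_deriv_iterate hf h.pos.le hn fun k hk =>
    h.le_norm_deriv _ (iterate_mem_juliaSet hf (hn.mono hk.le) hz) (hn k hk)

theorem two_pow_le {n : ℕ} {z : ℂ} (hz : z ∈ juliaSet f) (hn : IterateFiniteAt f n z)
    (hR : ∀ k, 1 ≤ k → k ≤ n → R ≤ ‖f^[k] z‖) : 2 ^ n ≤ ‖deriv f^[n] z‖ :=
  pow_le_norm_deriv_iterate hf zero_le_two hn fun k hk =>
    h.two_le_norm_deriv _ (iterate_mem_juliaSet hf (hn.mono hk.le) hz) (hn k hk) (by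
      rw [← Function.iterate_succ_apply' f]; exact hR (k + 1) (by omega) hk)

/-- The derivative up to the first entrance into the disk of radius `R`. -/
theorem entrance_le {i : ℕ} {z : ℂ} (hz : z ∈ juliaSet f) (hn : IterateFiniteAt f i z)
    (hR : ∀ k < i, R ≤ ‖f^[k] z‖) : b / 2 * 2 ^ i ≤ ‖deriv f^[i] z‖ := by
  have hb := h.pos
  rcases i with _ | j
  · simp; linarith [h.le_one]
  -- The first `j` steps land outside the disk and gain 2 each; the entering step is only bounded by
  -- `b`, whence `b / 2`.
  · have h1 := h.two_pow_le hf hz (hn.mono j.le_succ) fun k _ hk => hR k (by omega)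
    have h2 := h.le_norm_deriv _ (iterate_mem_juliaSet hf (hn.mono j.le_succ) hz) (hn j j.lt_succ_self)
    rw [add_comm] at hn
    rw [add_comm j 1, norm_deriv_iterate_add hf hn, Function.iterate_one, pow_add]
    calc b / 2 * (2 ^ 1 * 2 ^ j) = b * 2 ^ j := by ring
      _ ≤ _ := mul_le_mul h2 h1 (by positivity) (norm_nonneg _)

/-- A bound for the derivative along returns to the disk of radius `R` gives a bound along all
orbits that end in this disk. -/
theorem le_of_returns {n : ℕ} {z : ℂ} (hz : z ∈ juliaSet f) (hn : IterateFiniteAt f n z)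
    (hzR : ‖f^[n] z‖ < R) {B : ℝ}
    (hret : ∀ q ≤ n, ∀ y ∈ juliaSet f, ‖y‖ < R → IterateFiniteAt f q y → ‖f^[q] y‖ < R →
      B ≤ ‖deriv f^[q] y‖) : b / 2 * B ≤ ‖deriv f^[n] z‖ := by
  classical
  have hb := h.pos
  have hex : ∃ i, ‖f^[i] z‖ < R := ⟨n, hzR⟩
  obtain ⟨j, hj⟩ := Nat.exists_eq_add_of_le' (Nat.find_min' hex hzR)
  set i := Nat.find hex
  have hi : ‖f^[i] z‖ < R := Nat.find_spec hex
  rw [hj] at hn hzR ⊢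
  have hn' := iterateFiniteAt_add.1 hn
  have h1 := h.entrance_le hf hz hn'.1 fun k hk => not_lt.1 (Nat.find_min hex hk)
  have h2 := hret j (by omega) _ (iterate_mem_juliaSet hf hn'.1 hz) hi hn'.2
    (by rwa [← Function.iterate_add_apply])
  have h3 : b / 2 ≤ ‖deriv f^[i] z‖ :=
    (le_mul_of_one_le_right (by positivity) (one_le_pow₀ one_le_two)).trans h1
  rw [norm_deriv_iterate_add hf hn, mul_comm]
  exact mul_le_mul h2 h3 (by positivity) (norm_nonneg _)

/-- The derivative along returns is bounded away from zero. -/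
theorem exists_pos_le_returns
    (hkey : ∀ C > (0 : ℝ), ∃ N : ℕ, ∀ m ≥ N, ∀ y ∈ juliaSet f, ‖y‖ ≤ R → IterateFiniteAt f m y →
      ∃ n ≤ m, C < ‖deriv f^[n] y‖) :
    ∃ B > (0 : ℝ), ∀ q, ∀ y ∈ juliaSet f, ‖y‖ < R → IterateFiniteAt f q y → ‖f^[q] y‖ < R →
      B ≤ ‖deriv f^[q] y‖ := by
  classical
  have hb := h.pos
  obtain ⟨N, hN⟩ := hkey (2 / b) (by positivity)
  refine ⟨b ^ N, by positivity, ?_⟩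
  by_contra! hcon
  -- In a shortest counterexample, `q ≥ N` because shorter orbits satisfy `b ^ q ≥ b ^ N`. Some
  -- initial piece gains more than `2 / b`; the remainder is shorter, so it loses at most the factor
  -- `b / 2` against `b ^ N`, and the two cancel.
  set q := Nat.find hcon
  obtain ⟨y, hy, hyR, hfin, hqR, hlt⟩ := Nat.find_spec hcon
  change IterateFiniteAt f q y at hfin
  change ‖f^[q] y‖ < R at hqR
  change ‖deriv f^[q] y‖ < b ^ N at hlt
  have hqN : N ≤ q := by
    by_contra hlt'
    have h1 := h.pow_le hf hy hfin
    have h2 : b ^ N ≤ b ^ q := pow_le_pow_of_le_one hb.le h.le_one (by omega)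
    linarith
  obtain ⟨n, hnq, hn⟩ := hN q hqN y hy hyR.le hfin
  have hn0 : n ≠ 0 := by
    rintro rfl
    simp only [Function.iterate_zero, deriv_id, norm_one] at hn
    rw [div_lt_one hb] at hn
    linarith [h.le_one]
  obtain ⟨j, hj⟩ := Nat.exists_eq_add_of_le' hnq
  have hmin : ∀ k < q, ∀ y ∈ juliaSet f, ‖y‖ < R → IterateFiniteAt f k y → ‖f^[k] y‖ < R →
      b ^ N ≤ ‖deriv f^[k] y‖ := by
    intro k hk
    have := Nat.find_min hcon hk
    push Not at this
    exact this
  rw [hj] at hfin hqR hlt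
  have hfin' := iterateFiniteAt_add.1 hfin
  have h3 := h.le_of_returns hf (iterate_mem_juliaSet hf hfin'.1 hy) hfin'.2
    (by rwa [← Function.iterate_add_apply]) (B := b ^ N)
    fun k hk => hmin k (by omega)
  rw [norm_deriv_iterate_add hf hfin] at hlt
  have h4 : b / 2 * b ^ N * (2 / b) ≤ ‖deriv f^[j] (f^[n] y)‖ * ‖deriv f^[n] y‖ :=
    mul_le_mul h3 hn.le (by positivity) (norm_nonneg _)
  have h5 : b / 2 * b ^ N * (2 / b) = b ^ N := by field_simp
  linarith

/-- The derivative along long returns is large. -/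
theorem exists_le_long_returns
    (hkey : ∀ C > (0 : ℝ), ∃ N : ℕ, ∀ m ≥ N, ∀ y ∈ juliaSet f, ‖y‖ ≤ R → IterateFiniteAt f m y →
      ∃ n ≤ m, C < ‖deriv f^[n] y‖) {C : ℝ} (hC : 0 < C) :
    ∃ N, ∀ q ≥ N, ∀ y ∈ juliaSet f, ‖y‖ < R → IterateFiniteAt f q y → ‖f^[q] y‖ < R →
      C ≤ ‖deriv f^[q] y‖ := by
  have hb := h.pos
  obtain ⟨B, hB, hret⟩ := h.exists_pos_le_returns hf hkey
  obtain ⟨N, hN⟩ := hkey (C / (b / 2 * B)) (by positivity)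
  refine ⟨N, fun q hq y hy hyR hfin hqR => ?_⟩
  obtain ⟨n, hnq, hn⟩ := hN q hq y hy hyR.le hfin
  obtain ⟨j, rfl⟩ := Nat.exists_eq_add_of_le' hnq
  have hfin' := iterateFiniteAt_add.1 hfin
  have h3 := h.le_of_returns hf (iterate_mem_juliaSet hf hfin'.1 hy) hfin'.2
    (by rwa [← Function.iterate_add_apply]) fun k _ => hret k
  rw [norm_deriv_iterate_add hf hfin]
  calc C = b / 2 * B * (C / (b / 2 * B)) := by field_simp
    _ ≤ _ := mul_le_mul h3 hn.le (by positivity) (norm_nonneg _)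

/-- Some iterate doubles distances infinitesimally on the Julia set. -/
theorem exists_two_le
    (hkey : ∀ C > (0 : ℝ), ∃ N : ℕ, ∀ m ≥ N, ∀ y ∈ juliaSet f, ‖y‖ ≤ R → IterateFiniteAt f m y →
      ∃ n ≤ m, C < ‖deriv f^[n] y‖) :
    ∃ p, p ≠ 0 ∧ ∀ z ∈ juliaSet f, IterateFiniteAt f p z → 2 ≤ ‖deriv f^[p] z‖ := by
  classical
  have hb := h.pos
  obtain ⟨B, hB, hret⟩ := h.exists_pos_le_returns hf hkey
  obtain ⟨N, hN⟩ := h.exists_le_long_returns hf hkey (C := 4 / b) (by positivity)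
  obtain ⟨s, hs⟩ := pow_unbounded_of_one_lt (4 / (b * B)) (one_lt_two (α := ℝ))
  -- An orbit of this length either makes a return lasting at least `N` steps or spends more than
  -- `s` steps before its first and after its last visit to the disk. Either gain outweighs the loss
  -- `b / 2` at the entrance and, for short returns, the loss `B`.
  refine ⟨N + s + 1, by omega, fun z hz hfin => ?_⟩
  set p := N + s + 1 with hp
  by_cases hex : ∃ i, i ≤ p ∧ ‖f^[i] z‖ < R
  · -- first and last visit to the disk
    obtain ⟨hip, hiR⟩ := Nat.find_spec hex
    set i := Nat.find hex
    have hi : ∀ k < i, R ≤ ‖f^[k] z‖ := fun k hk => by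
      by_contra hlt
      exact Nat.find_min hex hk ⟨(hk.trans_le hip).le, not_le.1 hlt⟩
    set m := Nat.findGreatest (fun k => ‖f^[k] z‖ < R) p with hm
    have hmp : m ≤ p := Nat.findGreatest_le p
    have him : i ≤ m := Nat.le_findGreatest hip hiR
    have hmR : ‖f^[m] z‖ < R := Nat.findGreatest_spec (P := fun k => ‖f^[k] z‖ < R) hip hiR
    have hlast : ∀ k, m < k → k ≤ p → R ≤ ‖f^[k] z‖ := fun k hk hkp =>
      not_lt.1 (Nat.findGreatest_is_greatest (P := fun k => ‖f^[k] z‖ < R) hk hkp)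
    obtain ⟨q, hq⟩ := Nat.exists_eq_add_of_le' him
    obtain ⟨t, ht⟩ := Nat.exists_eq_add_of_le' hmp
    have hfinm := hfin.mono hmp
    have h1 := h.entrance_le hf hz (hfin.mono hip) hi
    rw [ht] at hfin ⊢
    have hfin2 := iterateFiniteAt_add.1 hfin
    have h2 := h.two_pow_le hf (iterate_mem_juliaSet hf hfin2.1 hz) hfin2.2 fun k hk1 hkt => by
      rw [← Function.iterate_add_apply]; exact hlast _ (by omega) (by omega)
    have hfinq : IterateFiniteAt f (q + i) z := hq ▸ hfinm
    have hfin3 := iterateFiniteAt_add.1 hfinq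
    have hqR : ‖f^[q] (f^[i] z)‖ < R := by rw [← Function.iterate_add_apply, ← hq]; exact hmR
    have hiJ := iterate_mem_juliaSet hf hfin3.1 hz
    have hdm : ‖deriv f^[m] z‖ = ‖deriv f^[q] (f^[i] z)‖ * ‖deriv f^[i] z‖ := by
      rw [hq, norm_deriv_iterate_add hf hfinq]
    rw [norm_deriv_iterate_add hf hfin, hdm]
    have hpow : ∀ n : ℕ, (1 : ℝ) ≤ 2 ^ n := fun n => one_le_pow₀ one_le_two
    rcases le_or_gt N q with hNq | hNq
    · have h3 := hN q hNq _ hiJ hiR hfin3.2 hqR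
      calc (2 : ℝ) = 1 * (4 / b * (b / 2 * 1)) := by field_simp; norm_num
        _ ≤ 2 ^ t * (4 / b * (b / 2 * 2 ^ i)) := by gcongr <;> exact hpow _
        _ ≤ _ := mul_le_mul h2 (mul_le_mul h3 h1 (by positivity) (norm_nonneg _)) (by positivity)
            (norm_nonneg _)
    · have h3 := hret q _ hiJ hiR hfin3.2 hqR
      have h4 : (2 : ℝ) ^ s ≤ 2 ^ (t + i) := pow_le_pow_right₀ one_le_two (by omega)
      calc (2 : ℝ) = 4 / (b * B) * (B * (b / 2)) := by field_simp; norm_num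
        _ ≤ 2 ^ (t + i) * (B * (b / 2)) := by gcongr; exact hs.le.trans h4
        _ = 2 ^ t * (B * (b / 2 * 2 ^ i)) := by rw [pow_add]; ring
        _ ≤ _ := mul_le_mul h2 (mul_le_mul h3 h1 (by positivity) (norm_nonneg _)) (by positivity)
            (norm_nonneg _)
  · push Not at hex
    refine le_trans ?_ (h.two_pow_le hf hz hfin fun k _ hk => hex k hk)
    exact le_self_pow₀ one_le_two (by omega)

/-- Writing `n = r + p * q` with `r < p`, the blocks of length `p` give `2 ^ q` and the remainder at
least `b ^ p`; the rate is `2 ^ (1 / p)`, and the `1 / 2` in the constant absorbs `l ^ r ≤ 2`. -/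
theorem isExpanding_of_two_le {p : ℕ} (hp : p ≠ 0)
    (h2 : ∀ z ∈ juliaSet f, IterateFiniteAt f p z → 2 ≤ ‖deriv f^[p] z‖) : IsExpanding f := by
  have hb := h.pos
  set l : ℝ := 2 ^ ((p : ℝ)⁻¹) with hl
  have hlp : l ^ p = 2 := Real.rpow_inv_natCast_pow zero_le_two hp
  have hl1 : 1 < l := Real.one_lt_rpow one_lt_two (by positivity)
  refine ⟨b ^ p / 2, by positivity, l, hl1, fun n z hz hfin => ?_⟩
  have hmul : ∀ q : ℕ, ∀ z ∈ juliaSet f, IterateFiniteAt f (p * q) z → 2 ^ q ≤ ‖deriv f^[p * q] z‖ := by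
    intro q
    induction q with
    | zero => intro z _ _; simp
    | succ q ih =>
      intro z hz hfin
      rw [Nat.mul_succ, add_comm (p * q)] at hfin ⊢
      have hfin' := iterateFiniteAt_add.1 hfin
      rw [norm_deriv_iterate_add hf hfin, pow_succ']
      exact mul_le_mul (h2 _ (iterate_mem_juliaSet hf hfin'.1 hz) hfin'.2) (ih z hz hfin'.1)
        (by positivity) (norm_nonneg _)
  have hn : n = n % p + p * (n / p) := (Nat.mod_add_div n p).symm
  set r := n % p
  set q := n / p
  have hr : r < p := Nat.mod_lt _ (Nat.pos_of_ne_zero hp)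
  rw [hn] at hfin ⊢
  have hfin' := iterateFiniteAt_add.1 hfin
  have h3 := hmul q z hz hfin'.1
  have h4 := h.pow_le hf (iterate_mem_juliaSet hf hfin'.1 hz) hfin'.2
  have h5 : b ^ p ≤ b ^ r := pow_le_pow_of_le_one hb.le h.le_one hr.le
  have h6 : l ^ r ≤ 2 := hlp ▸ pow_le_pow_right₀ hl1.le hr.le
  rw [norm_deriv_iterate_add hf hfin, pow_add, pow_mul, hlp]
  calc b ^ p / 2 * (l ^ r * 2 ^ q) ≤ b ^ p / 2 * (2 * 2 ^ q) := by gcongr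
    _ = b ^ p * 2 ^ q := by ring
    _ ≤ _ := mul_le_mul (h5.trans h4) h3 (by positivity) (norm_nonneg _)

end DerivLowerBound

theorem IsTopologicallyHyperbolic.exists_pos_le_dist (h : IsTopologicallyHyperbolic f) :
    ∃ δ > (0 : ℝ), ∀ z ∈ juliaSet f, ∀ w ∈ postcriticalSet f, δ ≤ dist z w := by
  -- The minimum with 1 makes the bound finite, since `setDist` is `⊤` when one of the sets is
  -- empty.
  have h1 : min (setDist (juliaSet f) (postcriticalSet f)) 1 ≠ ⊤ :=
    ((min_le_right _ _).trans_lt ENNReal.one_lt_top).ne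
  refine ⟨(min (setDist (juliaSet f) (postcriticalSet f)) 1).toReal,
    ENNReal.toReal_pos (lt_min h one_pos).ne' h1, fun z hz w hw => ?_⟩
  rw [dist_edist]
  refine ENNReal.toReal_mono (edist_ne_top z w) ((min_le_left _ _).trans ?_)
  exact (iInf₂_le z hz).trans (iInf₂_le w hw)

end MeroDyn

theorem propositionp1012805 (f : ℂ → ℂ) (hf : MeromorphicNFOn f Set.univ)
    (hhyp : MeroDyn.IsTopologicallyHyperbolic f)
    (α₁ : ℝ) (hα₁ : 0 ≤ α₁) (hgrowth : MeroDyn.HasRapidDerivativeGrowth f α₁) :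
    MeroDyn.IsExpanding f ∧ MeroDyn.IsHyperbolic f := by
  obtain ⟨δ, hδ, hJP⟩ := hhyp.exists_pos_le_dist
  obtain ⟨b, R, hbR⟩ := hgrowth.exists_derivLowerBound
  obtain ⟨p, hp, h2⟩ := hbR.exists_two_le hf fun C hC =>
    MeroDyn.exists_forall_exists_lt_norm_deriv hf hδ hJP hC R
  have hexp := hbR.isExpanding_of_two_le hf hp h2
  exact ⟨hexp, hhyp, hexp⟩
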